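/- Let $(W,S)$ be a Coxeter system with length function $l$ and Bruhat order $\le$, and let $s_1,s_2,s_3,s_4\in S$ be such that $s_1s_3,\ s_2s_3,\ s_4s_3$ have order $3$ and $s_1s_2,\ s_1s_4,\ s_2s_4$ have order $2$. Let $S_0=\{s_1,s_2,s_3,s_4\}$, let $W_{D_4}=\langle S_0\rangle$, and for $J\subseteq S$ let $W^J=\{a\in W: l(sa)>l(a)\text{ for all }s\in J\}$. Every $w\in W$ is uniquely $w=ua$ with $u\in W_J$, $a\in W^J$; write $p_J(w)=u$, and $p=p_{S_0}$. For $y\le w$ let $\mu(y,w)$ be the coefficient of $q^{(l(w)-l(y)-1)/2}$ in the Kazhdan–Lusztig polynomial $P_{y,w}(q)$ ($0$ if the exponent is not a non-negative integer). Put $\tilde\mu(y,w)=\mu(y,w)$ if $y\le w$, $\tilde\mu(y,w)=\mu(w,y)$ if $w<y$, and $\tilde\mu(y,w)=0$ otherwise. For $s,t\in S$ with $st$ of order $3$, let $D_{s,t}$ be the set of $w\in W$ with $l(tw)<l(w)$ and $l(sw)>l(w)$. The Knuth map $T_{s,t}$ is defined on $D_{s,t}$ by $T_{s,t}(w)=sw$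 if $p_{\{s,t\}}(w)=t$, and $T_{s,t}(w)=tw$ otherwise. Define eight subsets of $W_{D_4}$ (left cells of $W_{D_4}$), whose elements are labelled by types $A_i,B_i,C,D$ ($i\in\{1,2,4\}$), as follows. * $C(10,a)$ and $C(10,b)$, with $b=s_1s_2s_4$ and $b=s_1s_2s_4s_3$ respectively. Put $m=s_3b$. The elements are $b$ and $s_1s_2s_4m$ (type $C$); $m$ and $s_3s_1s_2s_4m$ (type $D$); $s_im$ (type $A_i$); $s_js_km$ (type $B_i$), for $\{i,j,k\}=\{1,2,4\}$. * $C(14,a,j)$, for $\{j,p,q\}=\{1,2,4\}$. Put $b=s_js_3s_j$ and $m=s_3s_ps_qb$. The elements are $b,\ s_jm$ (type $A_j$); $s_3s_pb,\ s_pm$ (type $A_p$); $s_3s_qb,\ s_qm$ (type $A_q$); $s_qs_3s_pb,\ s_ps_3s_qb$ (type $B_j$); $s_qb,\ s_js_qm$ (type $B_p$); $s_pb,\ s_js_pm$ (type $B_q$); $s_ps_qb$ (type $C$); $m$ (type $D$). * $C(14,b,k)$, for $\{k,p,q\}=\{1,2,4\}$. Put $b=s_ps_3s_ps_q$, $b'=s_qs_3s_qs_p$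 and $m=s_3s_ks_qb=s_3s_ks_pb'$. The elements are $b,\ s_pm$ (type $A_p$); $b',\ s_qm$ (type $A_q$); $s_3s_kb,\ s_3s_kb'$ (type $A_k$); $s_kb,\ s_ps_3s_kb'$ (type $B_q$); $s_kb',\ s_qs_3s_kb$ (type $B_p$); $s_qb=s_pb',\ s_ps_qm$ (type $B_k$); $s_ks_qb$ (type $C$); $m$ (type $D$). An element $w\in W$ has the type of $p(w)$ whenever $p(w)$ lies in one of the eight cells. Let $X(10,a)=\{w\in W: p(w)\in C(10,a)\}$, and similarly for the other cells. A clump is a set $\kappa a$, where $\kappa$ is one of the eight cells and $a\in W^{S_0}$. Let $C$ and $C'$ be clumps with $C'\subseteq W_{D_4}C$. Below, $y\in C$ and $w\in C'$ are of the same type. The transports of a set of pairs are all pairs obtained from its members by repeatedly replacing $(y,w)$ with $(T_{s,t}(y),T_{s,t}(w))$, whenever $s,t\in S_0$, $st$ has order $3$ and $y,w\in D_{s,t}$. 1. Suppose $C\subseteq X(10,a)$ and $C'\subseteq X(10,b)$. Consider the three pairs $(y,w)\in C\times C'$ for which $(p(y),p(w))=(u,us_3)$ with $u=s_1s_2s_4$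 (lower elements of type $C$), $u=s_4s_3s_1s_2s_4$ (elements of type $A_4$), or $u=s_1s_2s_4s_3s_1s_2s_4$ (upper elements of type $C$). They have exactly seven further transports; these ten pairs are pairs of elements of the same type, and $\tilde\mu(y,w)=1$ for them. For all other $y,w$, $\tilde\mu(y,w)=0$. 2. Suppose $C\subseteq X(14,a,j)$ and $C'\subseteq X(14,b,k)$ with $\{i,j,k\}=\{1,2,4\}$. Consider the three pairs $(y,w)\in C\times C'$ for which $(p(y),p(w))=(u,us_i)$ with $u=s_js_3s_j$ (lower elements of type $A_j$), $u=s_is_ks_js_3s_j$ (elements of type $C$), or $u=s_js_3s_is_ks_js_3s_j$ (upper elements of type $A_j$). They have exactly eleven further transports; these fourteen pairs are pairs of elements of the same type, and $\tilde\mu(y,w)=1$ for them. For all other $y,w$, $\tilde\mu(y,w)=0$. 3. If $C\subseteq X(10,a)$ and $C'\subseteq X(14,b,j)$ for some $j\in\{1,2,4\}$, then $\tilde\mu(y,w)=1$ for all $y,w$. 4. If $C\subseteq X(14,a,j)$ and $C'\subseteq X(10,b)$ for some $j\in\{1,2,4\}$, then $\tilde\mu(y,w)=1$ for all $y,w$.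 5. If the unordered pair $\{C,C'\}$ is in none of the situations 1–4 (that is, neither $(C,C')$ nor $(C',C)$ is), then $\tilde\mu(y,w)=0$ for all $y,w$. -/

import Mathlib

open scoped LaurentPolynomial Pointwise

namespace KLD4

section General

variable {B W : Type*} [Group W] {M : CoxeterMatrix B} (cs : CoxeterSystem M W)

/-! ## Bruhat order -/

/-- The Bruhat order: `y ≤ w` if `w` is reached from `y` by successive multiplications by
reflections, each of which increases the length. -/
def BruhatLE (y w : W) : Prop :=
  Relation.ReflTransGen
    (fun u v : W => cs.length u < cs.length v ∧ ∃ t : W, cs.IsReflection t ∧ v = u * t) y w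

/-! ## The Hecke algebra as a left module over itself, and its bar involution

The Hecke algebra is the free `ℤ[q, q⁻¹]`-module on the standard basis `T_w`, `w ∈ W`
(`T_w` is `Finsupp.single w 1`), and only left multiplication by the generators `T_s` is used. -/

/-- The free `ℤ[q, q⁻¹]`-module underlying the Hecke algebra. -/
abbrev Hecke (W : Type*) : Type _ := W →₀ ℤ[T;T⁻¹]

/-- The indeterminate `q`. -/
noncomputable def qVar : ℤ[T;T⁻¹] := LaurentPolynomial.T 1

open Classical in
/-- Left multiplication by `T_s`, where `s` is the simple reflection with index `i`:
`T_s T_w = T_{sw}` if `l(sw) > l(w)` and `T_s T_w = (q - 1) T_w + q T_{sw}` if `l(sw) < l(w)`. -/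
noncomputable def heckeGen (i : B) : Module.End ℤ[T;T⁻¹] (Hecke W) :=
  Finsupp.linearCombination ℤ[T;T⁻¹] (fun w : W =>
    if cs.IsLeftDescent w i then
      Finsupp.single w (qVar - 1) + Finsupp.single (cs.simple i * w) qVar
    else Finsupp.single (cs.simple i * w) 1)

/-- Left multiplication by `T_s⁻¹ = q⁻¹ T_s + (q⁻¹ - 1)`. -/
noncomputable def heckeGenInv (i : B) : Module.End ℤ[T;T⁻¹] (Hecke W) :=
  (LaurentPolynomial.T (-1) : ℤ[T;T⁻¹]) • heckeGen cs i +
    (LaurentPolynomial.T (-1) - 1 : ℤ[T;T⁻¹]) • (1 : Module.End ℤ[T;T⁻¹] (Hecke W))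

/-- A reduced word for `w`. -/
noncomputable def redWord (w : W) : List B := (cs.exists_isReduced w).choose

/-- The element `(T_{w⁻¹})⁻¹ = T_{s_1}⁻¹ ⋯ T_{s_k}⁻¹`, where `w = s_1 ⋯ s_k` is reduced. -/
noncomputable def barBasis (w : W) : Hecke W :=
  (((redWord cs w).map (heckeGenInv cs)).prod) (Finsupp.single 1 1)

/-- The bar involution of the Hecke algebra: `q ↦ q⁻¹` and `T_w ↦ (T_{w⁻¹})⁻¹`. -/
noncomputable def bar (h : Hecke W) : Hecke W :=
  h.sum (fun w a => LaurentPolynomial.invert a • barBasis cs w)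

/-! ## Kazhdan-Lusztig polynomials -/

/-- `P` is the family `y ↦ P_{y,w}` of Kazhdan-Lusztig polynomials for the given `w`:
it is supported on `y ≤ w`, `P_{w,w} = 1`, `deg P_{y,w} ≤ (l(w) - l(y) - 1) / 2` for `y < w`, and
`q^{-l(w)/2} ∑_{y ≤ w} P_{y,w} T_y` is fixed by the bar involution. The last condition is written
without square roots of `q`, as `bar (∑ P_{y,w} T_y) = q^{-l(w)} ∑ P_{y,w} T_y`. -/
structure IsKLFamily (w : W) (P : W →₀ Polynomial ℤ) : Prop where
  support : ∀ y : W, ¬ BruhatLE cs y w → P y = 0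
  diag : P w = 1
  degree : ∀ y : W, BruhatLE cs y w → y ≠ w →
    2 * (P y).natDegree + cs.length y + 1 ≤ cs.length w
  bar_eq : bar cs (P.mapRange Polynomial.toLaurent (map_zero _)) =
    (LaurentPolynomial.T (-(cs.length w : ℤ)) : ℤ[T;T⁻¹]) •
      (P.mapRange Polynomial.toLaurent (map_zero _) : Hecke W)

/-- The Kazhdan-Lusztig polynomial `P_{y,w}`, taken from the unique Kazhdan-Lusztig family
for `w`. -/
noncomputable def klPoly (y w : W) : Polynomial ℤ :=
  Classical.epsilon (IsKLFamily cs w) y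

open Classical in
/-- `μ(y, w)`: the coefficient of `q^{(l(w) - l(y) - 1)/2}` in `P_{y,w}` if `y ≤ w`, which is `0`
when the exponent is not a natural number; and `0` if `y ≰ w`. -/
noncomputable def mu (y w : W) : ℤ :=
  if BruhatLE cs y w ∧ Odd (cs.length w - cs.length y) then
    (klPoly cs y w).coeff ((cs.length w - cs.length y - 1) / 2)
  else 0

open Classical in
/-- The symmetrized function `μ̃(y, w)`. -/
noncomputable def muTilde (y w : W) : ℤ :=
  if BruhatLE cs y w then mu cs y w
  else if BruhatLE cs w y then mu cs w y
  else 0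

/-! ## Parabolic subgroups and Knuth maps -/

/-- The parabolic subgroup `W_J`. -/
def parabolic (J : Set B) : Subgroup W := Subgroup.closure (cs.simple '' J)

/-- `W^J`, the set of `a ∈ W` with `s a > a` for all `s ∈ J`. -/
def minReps (J : Set B) : Set W := {a | ∀ i ∈ J, ¬ cs.IsLeftDescent a i}

/-- `p_J(w) = u`, where `p_J` is the projection `W → W_J`: `w = u a` with `u ∈ W_J`, `a ∈ W^J`. -/
def IsProj (J : Set B) (w u : W) : Prop :=
  u ∈ parabolic cs J ∧ ∃ a ∈ minReps cs J, w = u * a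

/-- The domain `D_{s,t}(W) = {w ∣ τ(w) ∩ {s,t} = {t}}` of the Knuth map `T_{s,t}`. -/
def knuthDomain (s t : B) : Set W := {w | cs.IsLeftDescent w t ∧ ¬ cs.IsLeftDescent w s}

open Classical in
/-- The Knuth map `T_{s,t}` on `D_{s,t}(W)`, where `st` has order 3: with `J = {s,t}`,
`T_{s,t}(w) = s w` if `p_J(w) = t`, and `T_{s,t}(w) = t w` otherwise. -/
noncomputable def knuthMap (s t : B) (w : W) : W :=
  if IsProj cs {s, t} w (cs.simple t) then cs.simple s * w else cs.simple t * w

end General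

/-! ## The `D_4` situation -/

/-- The labels `1, 2, 4` of the three outer nodes of the Dynkin diagram `D_4`. The central node
has label `3`. -/
inductive Leg where
  | l1 | l2 | l4

/-- The two outer nodes other than a given one. -/
def Leg.others : Leg → Leg × Leg
  | .l1 => (.l2, .l4)
  | .l2 => (.l1, .l4)
  | .l4 => (.l1, .l2)

/-- Simple reflections `s_1, s_2, s_4` (`leg`) and `s_3` (`center`) forming a subdiagram of
type `D_4`. -/
structure D4Sub {B : Type*} (M : CoxeterMatrix B) where
  leg : Leg → B
  center : B
  leg_center : ∀ i, M (leg i) center = 3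
  leg_leg : ∀ i j, i ≠ j → M (leg i) (leg j) = 2

/-- The types `A_i`, `B_i`, `C`, `D` that label the elements of the cells. -/
inductive NodeType where
  | A (i : Leg) | B (i : Leg) | C | D

/-- The names of the eight left cells `C(10,a)`, `C(10,b)`, `C(14,a,j)`, `C(14,b,j)`. -/
inductive CellName where
  | tenA | tenB | fourteenA (j : Leg) | fourteenB (j : Leg)

section D4

variable {B W : Type*} [Group W] {M : CoxeterMatrix B} (cs : CoxeterSystem M W) (d : D4Sub M)

/-- The set `S_0 = {s_1, s_2, s_3, s_4}`. -/
def gens : Set B := insert d.center (Set.range d.leg)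

/-- The ten labelled elements, as words in `s_1, s_2, s_3, s_4`, of the diagram of `C(10,a)` or
`C(10,b)` with bottom element `b`. From bottom to top: `C`, `D = s_3 b`, `A_i = s_i D`,
`B_i = s_j s_k D` for `{i,j,k} = {1,2,4}`, the upper `C = s_1 s_2 s_4 D`, and the upper `D`. -/
def diagram10 (b : List B) : List (NodeType × List B) :=
  let s1 := d.leg .l1
  let s2 := d.leg .l2
  let s3 := d.center
  let s4 := d.leg .l4
  [(.C, b), (.D, s3 :: b),
   (.A .l1, s1 :: s3 :: b), (.A .l2, s2 :: s3 :: b), (.A .l4, s4 :: s3 :: b),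
   (.B .l1, s2 :: s4 :: s3 :: b), (.B .l2, s1 :: s4 :: s3 :: b), (.B .l4, s1 :: s2 :: s3 :: b),
   (.C, s1 :: s2 :: s4 :: s3 :: b), (.D, s3 :: s1 :: s2 :: s4 :: s3 :: b)]

/-- The fourteen labelled elements of the diagram of `C(14,a,j)`, from bottom to top, as words;
`b = s_j s_3 s_j` is the bottom element and `m` is the element of type `D`. -/
def diagram14a (j : Leg) : List (NodeType × List B) :=
  let p := j.others.1
  let q := j.others.2
  let sj := d.leg j
  let sp := d.leg p
  let sq := d.leg q
  let s3 := d.center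
  let b := [sj, s3, sj]
  let m := s3 :: sp :: sq :: b
  [(.A j, b),
   (.B q, sp :: b), (.B p, sq :: b),
   (.A p, s3 :: sp :: b), (.C, sp :: sq :: b), (.A q, s3 :: sq :: b),
   (.B j, sq :: s3 :: sp :: b), (.D, m), (.B j, sp :: s3 :: sq :: b),
   (.A j, sj :: m), (.A p, sp :: m), (.A q, sq :: m),
   (.B p, sj :: sq :: m), (.B q, sj :: sp :: m)]

/-- The fourteen labelled elements of the diagram of `C(14,b,k)`, from bottom to top, as words;
`b` and `b2` are the two bottom elements and `m` is the element of type `D`. -/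
def diagram14b (k : Leg) : List (NodeType × List B) :=
  let p := k.others.1
  let q := k.others.2
  let sk := d.leg k
  let sp := d.leg p
  let sq := d.leg q
  let s3 := d.center
  let b := [sp, s3, sp, sq]
  let b2 := [sq, s3, sq, sp]
  let m := s3 :: sk :: sq :: b
  [(.A p, b), (.A q, b2),
   (.B q, sk :: b), (.B k, sq :: b), (.B p, sk :: b2),
   (.A k, s3 :: sk :: b), (.C, sk :: sq :: b), (.A k, s3 :: sk :: b2),
   (.B p, sq :: s3 :: sk :: b), (.D, m), (.B q, sp :: s3 :: sk :: b2),
   (.A q, sq :: m), (.A p, sp :: m),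
   (.B k, sp :: sq :: m)]

/-- The labelled elements of each of the eight cells. The bottom element is `s_1 s_2 s_4` for
`C(10,a)` and `s_1 s_2 s_4 s_3` for `C(10,b)`. -/
def diagram : CellName → List (NodeType × List B)
  | .tenA => diagram10 d [d.leg .l1, d.leg .l2, d.leg .l4]
  | .tenB => diagram10 d [d.leg .l1, d.leg .l2, d.leg .l4, d.center]
  | .fourteenA j => diagram14a d j
  | .fourteenB k => diagram14b d k

/-- The cell, a subset of `W_{D_4}`. -/
def cell (κ : CellName) : Set W := {u | ∃ x ∈ diagram d κ, u = cs.wordProd x.2}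

/-- `w` is of type `t`: its projection to `W_{D_4}` is an element with label `t` in one of the
eight cells. -/
def HasType (w : W) (t : NodeType) : Prop :=
  ∃ κ : CellName, ∃ x ∈ diagram d κ, x.1 = t ∧ IsProj cs (gens d) w (cs.wordProd x.2)

/-- `X(10,a)`, `X(10,b)`, `X(14,a,j)`, `X(14,b,j)`: the elements of `W` whose projection to
`W_{D_4}` lies in the given cell. -/
def X (κ : CellName) : Set W := {w | ∃ u ∈ cell cs d κ, IsProj cs (gens d) w u}

/-- A clump is a set `C(10,a) a` (or similarly for the other cells) with `a ∈ W^{S_0}`. -/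
def IsClump (C : Set W) : Prop :=
  ∃ κ : CellName, ∃ a ∈ minReps cs (gens d), C = (fun u : W => u * a) '' cell cs d κ

/-- The pairs `(y, w)` of elements of the same type with `y ∈ C`, `w ∈ C'`. -/
def sameTypePairs (C C' : Set W) : Set (W × W) :=
  {e | e.1 ∈ C ∧ e.2 ∈ C' ∧ ∃ t : NodeType, HasType cs d e.1 t ∧ HasType cs d e.2 t}

/-- The three dotted edges between `C(10,a)` and `C(10,b)`, as pairs of words: between the lower
elements of type `C`, between the elements of type `A_4`, and between the upper elements of
type `C`. -/
def edges10 : List (List B × List B) :=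
  let s1 := d.leg .l1
  let s2 := d.leg .l2
  let s3 := d.center
  let s4 := d.leg .l4
  [([s1, s2, s4], [s1, s2, s4, s3]),
   ([s4, s3, s1, s2, s4], [s4, s3, s1, s2, s4, s3]),
   ([s1, s2, s4, s3, s1, s2, s4], [s1, s2, s4, s3, s1, s2, s4, s3])]

/-- The three dotted edges between `C(14,a,j)` and `C(14,b,k)`, where `{i,j,k} = {1,2,4}`, as pairs
of words: between the lower elements of type `A_j`, between the elements of type `C`, and between
the upper elements of type `A_j`. -/
def edges14 (i j k : Leg) : List (List B × List B) :=
  let si := d.leg i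
  let sj := d.leg j
  let sk := d.leg k
  let s3 := d.center
  [([sj, s3, sj], [sj, s3, sj, si]),
   ([si, sk, sj, s3, sj], [sk, si, sj, s3, sj, si]),
   ([sj, s3, si, sk, sj, s3, sj], [sj, s3, sk, si, sj, s3, sj, si])]

/-- The edges between the clumps `C` and `C'` whose end points project to the end points of one of
the edges in the list `E` of pairs of words. -/
def baseEdges (E : List (List B × List B)) (C C' : Set W) : Set (W × W) :=
  {e | e.1 ∈ C ∧ e.2 ∈ C' ∧ ∃ x ∈ E,
    IsProj cs (gens d) e.1 (cs.wordProd x.1) ∧ IsProj cs (gens d) e.2 (cs.wordProd x.2)}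

/-- `Transported cs d E y w`: the edge `(y, w)` is in `E`, or is obtained from an edge in `E` by
applying Knuth maps `T_{s,t}` (`s, t ∈ S_0`, `st` of order 3) to both end points. -/
inductive Transported (E : Set (W × W)) : W → W → Prop
  | base {y w : W} (h : (y, w) ∈ E) : Transported E y w
  | step {y w : W} {s t : B} (hs : s ∈ gens d) (ht : t ∈ gens d) (hst : M s t = 3)
      (hy : y ∈ knuthDomain cs s t) (hw : w ∈ knuthDomain cs s t) (h : Transported E y w) :
      Transported E (knuthMap cs s t y) (knuthMap cs s t w)

/-- The set of all edges obtained from `E` by Knuth transport, including those of `E`. -/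
def transportedEdges (E : Set (W × W)) : Set (W × W) := {e | Transported cs d E e.1 e.2}

end D4

/-- The ordered pairs of cells that are treated separately; the remaining pairs have no edges between
elements of the same type. -/
inductive Listed : CellName → CellName → Prop
  | ten_ten : Listed .tenA .tenB
  | fourteen_fourteen (j k : Leg) (h : j ≠ k) : Listed (.fourteenA j) (.fourteenB k)
  | ten_fourteen (j : Leg) : Listed .tenA (.fourteenB j)
  | fourteen_ten (j : Leg) : Listed (.fourteenA j) .tenB

end KLD4

open KLD4

/-!
The type of an element, the cells and the transports of edges only involve the coset `W_{D_4} a` of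
a clump. So does `μ̃`, on elements of that coset: the polynomial `P_{xa,wa}`, for `x`, `w` in
`W_{D_4}` and `a ∈ W^{S_0}`, does not depend on `a`, nor on the Coxeter group around `W_{D_4}`, and
the theorem is a finite computation in the Coxeter group of type `D_4`, which has 192 elements.

The independence comes from the recursion for Kazhdan-Lusztig polynomials: if `s w > w`, then
`(T_s + 1) ∑ P_{x,w} T_x` is the sum of `∑ P_{x,sw} T_x` and of correction terms
`μ(z, w) q^{(l(w) - l(z) + 1) / 2} ∑ P_{x,z} T_x` over `z < w` with `s z < z`
(`klFamily_simple_mul`). It rests on the existence and uniqueness of the Kazhdan-Lusztig basis, for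
which the bar involution is shown to be compatible with left multiplication by `T_s`
(`bar_heckeGen`); the operator `T_w` is independent of the reduced word of `w` because it commutes
with right multiplications (`wordProd_leftMul_eq`). For `w = u a` and `x = v a` in the coset
`W_{D_4} a`, an element `z` with `x ≤ z ≤ w` is again in the coset, since the length of the minimal
representative increases strictly along the Bruhat order when the coset changes
(`minReps_of_bruhatLE`). Hence the recursion restricts to the coset (`cosetKL_lmul`), where lengths
and descents are those of `W_{D_4}`, and it determines all `P_{xa,wa}` from the value `1` at
`x = w = 1`. These facts on cosets, and the Bruhat order, are based on the strong exchange property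
(`strong_exchange`).

The group `W_{D_4}` is handled through a left multiplication table with elements numbered from `0`
to `191`. A map `embed` from numbers to `W` is defined by recursion along descents; the table satisfies
the commutation and braid relations, which makes `embed` compatible with left multiplication, and
an induction over dihedral cosets shows that ascents in the table are ascents in `W`
(`not_isLeftDescent_embed`), so `embed` is injective and preserves lengths (`length_embed`). This
uses that different indices have different simple reflections, which is seen in the geometric
representation (`simple_injective`).

A table of the polynomials for `l(w) ≤ 9` is packed into one number `klTable`, and the kernel checks
that it satisfies the recursion (`isKLTable_klTable`, `cosetKL_coeff`), that `μ̃` has the values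
asserted (`muSpec_klTable`), and that the sets of edges are closed under Knuth maps and have the
sizes asserted (`edgeCount_ten`, `edgeCount_fourteen`).
-/

namespace KLD4

/-! ### The geometric representation separates the simple reflections -/

section Geometric

open Module Polynomial.Chebyshev

/-- Twice the bilinear form of the geometric representation, as a function of the order `m`. -/
noncomputable def cosForm (m : ℕ) : ℝ := -2 * Real.cos (Real.pi / m)

/-- The zeros of the Chebyshev polynomials `S` that make the product of two reflections with even
order parameter `m` have order dividing `m`; the next lemma is the analogue for odd `m`. -/
lemma chebyshevS_eval_eq_zero {m : ℕ} (hm : 3 ≤ m) {n : ℤ} (hn : 2 * (n + 1) = m) :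
    (S ℝ n).eval (2 * Real.cos (2 * Real.pi / m)) = 0 := by
  have hm0 : (0 : ℝ) < m := by positivity
  have h3 : (3 : ℝ) ≤ m := by exact_mod_cast hm
  have hs : Real.sin (2 * Real.pi / m) ≠ 0 := by
    apply ne_of_gt
    apply Real.sin_pos_of_pos_of_lt_pi
    · positivity
    · rw [div_lt_iff₀ hm0]; nlinarith [Real.pi_pos]
  have h := S_two_mul_real_cos (2 * Real.pi / m) n
  have hn' : 2 * ((n : ℝ) + 1) = m := by exact_mod_cast hn
  have : ((n : ℝ) + 1) * (2 * Real.pi / m) = Real.pi := by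
    field_simp; linarith
  rw [this, Real.sin_pi] at h
  exact (mul_eq_zero.mp h).resolve_right hs

lemma chebyshevS_eval_add_eq_zero {m : ℕ} (hm : 3 ≤ m) {n : ℤ} (hn : 2 * n + 1 = m) :
    (S ℝ n).eval (2 * Real.cos (2 * Real.pi / m)) +
      (S ℝ (n - 1)).eval (2 * Real.cos (2 * Real.pi / m)) = 0 := by
  have hm0 : (0 : ℝ) < m := by positivity
  have h3 : (3 : ℝ) ≤ m := by exact_mod_cast hm
  have hs : Real.sin (2 * Real.pi / m) ≠ 0 := by
    apply ne_of_gt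
    apply Real.sin_pos_of_pos_of_lt_pi
    · positivity
    · rw [div_lt_iff₀ hm0]; nlinarith [Real.pi_pos]
  have h1 := S_two_mul_real_cos (2 * Real.pi / m) n
  have h2 := S_two_mul_real_cos (2 * Real.pi / m) (n - 1)
  have hn' : 2 * (n : ℝ) + 1 = m := by exact_mod_cast hn
  have e : ((n : ℝ) + 1) * (2 * Real.pi / m) =
      2 * Real.pi - (((n - 1 : ℤ) : ℝ) + 1) * (2 * Real.pi / m) := by
    push_cast; field_simp; linarith
  rw [e, Real.sin_two_pi_sub] at h1
  have := congrArg₂ (· + ·) h1 h2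
  simp only [neg_add_cancel, ← add_mul] at this
  exact (mul_eq_zero.mp this).resolve_right hs

lemma cosForm_sq (m : ℕ) : cosForm m * cosForm m - 2 = 2 * Real.cos (2 * Real.pi / m) := by
  unfold cosForm
  have : 2 * Real.pi / m = 2 * (Real.pi / m) := by ring
  rw [this, Real.cos_two_mul]; ring

/-- The relations of the Coxeter group hold in the geometric representation, by the formula for the
powers of a product of two reflections in terms of Chebyshev polynomials. -/
lemma reflection_mul_reflection_pow_eq_one {V : Type*} [AddCommGroup V] [Module ℝ V] {x y : V}
    {f g : Dual ℝ V} (hf : f x = 2) (hg : g y = 2) {m : ℕ} (hm : 2 ≤ m)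
    (h1 : f y = cosForm m) (h2 : g x = cosForm m) :
    (reflection hf * reflection hg) ^ m = 1 := by
  ext z
  rw [reflection_mul_reflection_pow_apply hf hg m z, h1, h2, cosForm_sq]
  rcases hm.eq_or_lt with rfl | hm
  · have h0 : cosForm 2 = 0 := by simp [cosForm]
    norm_num [h0]
    abel
  · rcases Nat.even_or_odd' m with ⟨k, rfl | rfl⟩
    · have e1 : (((2 * k : ℕ) : ℤ) - 2) / 2 = k - 1 := by push_cast; lia
      have e2 : (((2 * k : ℕ) : ℤ) - 1) / 2 = k - 1 := by push_cast; lia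
      have h := chebyshevS_eval_eq_zero (m := 2 * k) (by lia) (n := k - 1) (by push_cast; ring)
      rw [e1, e2, h]; simp
    · have e1 : (((2 * k + 1 : ℕ) : ℤ) - 1) / 2 = k := by push_cast; lia
      have e2 : (((2 * k + 1 : ℕ) : ℤ) - 3) / 2 = k - 1 := by push_cast; lia
      have e3 : (((2 * k + 1 : ℕ) : ℤ)) / 2 = k := by push_cast; lia
      have e4 : (((2 * k + 1 : ℕ) : ℤ) - 2) / 2 = k - 1 := by push_cast; lia
      have h := chebyshevS_eval_add_eq_zero (m := 2 * k + 1) (by lia) (n := k) (by push_cast; ring)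
      rw [e1, e2, e3, e4, h]; simp

variable {B W : Type*} [Group W] {M : CoxeterMatrix B}

/-- The functional `v ↦ 2 B(α_i, v)` of the geometric representation. -/
noncomputable def coroot (M : CoxeterMatrix B) (i : B) : Dual ℝ (B →₀ ℝ) :=
  Finsupp.linearCombination ℝ (fun j => cosForm (M i j))

lemma coroot_single (i j : B) : coroot M i (Finsupp.single j 1) = cosForm (M i j) := by
  simp [coroot]

lemma coroot_self (i : B) : coroot M i (Finsupp.single i 1) = 2 := by
  simp [coroot_single, cosForm]

/-- Different indices have different simple reflections: their reflections in the geometric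
representation differ in the value at a simple root. -/
theorem simple_injective (cs : CoxeterSystem M W) : Function.Injective cs.simple := by
  have hl : M.IsLiftable (fun i : B => reflection (coroot_self (M := M) i)) := by
    intro i j
    rcases Nat.lt_or_ge (M i j) 2 with h | h
    · rcases Nat.lt_or_ge (M i j) 1 with h' | h'
      · rw [Nat.lt_one_iff.mp h', pow_zero]
      · have h1 : M i j = 1 := by lia
        have : i = j := by
          by_contra hne
          exact M.off_diagonal i j hne h1
        subst this
        rw [h1, pow_one]
        ext1 v
        exact involutive_reflection (coroot_self (M := M) i) v
    · exact reflection_mul_reflection_pow_eq_one _ _ h (coroot_single i j)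
        (by rw [coroot_single, M.symmetric])
  intro i j hij
  by_contra hne
  have h := congrArg (cs.lift ⟨_, hl⟩) hij
  rw [cs.lift_apply_simple hl, cs.lift_apply_simple hl] at h
  have h1 := congrArg (fun v : B →₀ ℝ => v i) (LinearEquiv.congr_fun h (Finsupp.single i 1))
  simp [reflection_apply, Ne.symm hne] at h1
  norm_num at h1

end Geometric

/-! ### The strong exchange property -/

section Exchange

variable {B W : Type*} [Group W] {M : CoxeterMatrix B} (cs : CoxeterSystem M W)

open Classical in
/-- The action of the simple reflection `s_i` on `W × ZMod 2`, by `(t, ε) ↦ (s t s, ε + [t = s])`.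
On pairs whose first entry is a reflection, this is the permutation action on the roots. -/
noncomputable def signedConj (i : B) : Function.End (W × ZMod 2) :=
  fun p => (cs.simple i * p.1 * cs.simple i, p.2 + if p.1 = cs.simple i then 1 else 0)

lemma pow_mul_simple_mul_pow (i j : B) (k : ℕ) :
    (cs.simple i * cs.simple j) ^ k * cs.simple j * (cs.simple i * cs.simple j) ^ k =
      cs.simple j := by
  induction k with
  | zero => simp
  | succ k ih =>
    rw [pow_succ]
    nth_rw 2 [← pow_succ]
    rw [pow_succ']
    simp only [mul_assoc, CoxeterSystem.simple_mul_simple_cancel_left] at ih ⊢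
    exact ih

open Classical in
/-- The sum counts the occurrences of `t` in the inversion sequence of the word `(ij)^k`, of length
`2k`. For `k = M i j` every element occurs an even number of times. -/
lemma signedConj_pow_apply (i j : B) (k : ℕ) (t : W) (ε : ZMod 2) :
    ((signedConj cs i * signedConj cs j) ^ k) (t, ε) =
      ((cs.simple i * cs.simple j) ^ k * t * ((cs.simple i * cs.simple j) ^ k)⁻¹,
        ε + ∑ n ∈ Finset.range (2 * k),
          if t = cs.simple j * (cs.simple i * cs.simple j) ^ n then 1 else 0) := by
  induction k with
  | zero =>
    rw [pow_zero, Function.End.one_def]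
    simp
  | succ k ih =>
    have hs : ((signedConj cs i * signedConj cs j) ^ (k + 1)) (t, ε) =
        signedConj cs i (signedConj cs j (((signedConj cs i * signedConj cs j) ^ k) (t, ε))) := by
      rw [pow_succ']; rfl
    rw [hs, ih]
    set r := cs.simple i * cs.simple j with hr
    have hk := pow_mul_simple_mul_pow cs i j k
    rw [← hr] at hk
    have e1 : (r ^ k * t * (r ^ k)⁻¹ = cs.simple j) ↔ t = cs.simple j * r ^ (2 * k) := by
      rw [mul_inv_eq_iff_eq_mul, ← eq_inv_mul_iff_mul_eq]
      nth_rw 1 [← hk]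
      rw [two_mul, pow_add]
      simp only [mul_assoc, inv_mul_cancel_left]
    have e2 : (cs.simple j * (r ^ k * t * (r ^ k)⁻¹) * cs.simple j = cs.simple i) ↔
        t = cs.simple j * r ^ (2 * k + 1) := by
      have h3 : (cs.simple j * (r ^ k * t * (r ^ k)⁻¹) * cs.simple j = cs.simple i) ↔
          r ^ k * t * (r ^ k)⁻¹ = cs.simple j * r := by
        generalize r ^ k * t * (r ^ k)⁻¹ = z
        rw [hr]
        constructor
        · intro h
          rw [← h]
          simp [mul_assoc]
        · intro h
          rw [h]
          simp [mul_assoc]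
      rw [h3, mul_inv_eq_iff_eq_mul, ← eq_inv_mul_iff_mul_eq]
      nth_rw 1 [← hk]
      rw [two_mul, add_assoc, pow_add, pow_succ']
      simp only [mul_assoc, inv_mul_cancel_left]
    rw [show 2 * (k + 1) = 2 * k + 1 + 1 by ring, Finset.sum_range_succ, Finset.sum_range_succ]
    refine Prod.ext ?_ ?_
    · simp only [signedConj]
      rw [pow_succ', hr]
      simp [mul_assoc]
    · simp only [signedConj, e1, e2]
      ring

lemma isLiftable_signedConj : M.IsLiftable (signedConj cs) := by
  classical
  intro i j
  funext ⟨t, ε⟩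
  rw [signedConj_pow_apply, cs.simple_mul_simple_pow, two_mul, Finset.sum_range_add]
  rw [Function.End.one_def]
  simp [pow_add, cs.simple_mul_simple_pow, CharTwo.add_self_eq_zero]

/-- The action of `W` on `W × ZMod 2` that extends `signedConj`. -/
noncomputable def signedAct : W →* Function.End (W × ZMod 2) :=
  cs.lift ⟨_, isLiftable_signedConj cs⟩

lemma signedAct_simple (i : B) : signedAct cs (cs.simple i) = signedConj cs i :=
  cs.lift_apply_simple (isLiftable_signedConj cs) i

lemma signedAct_mul (v w : W) (p : W × ZMod 2) :
    signedAct cs (v * w) p = signedAct cs v (signedAct cs w p) := by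
  rw [map_mul]; rfl

open Classical in
lemma signedAct_wordProd (ω : List B) (t : W) (ε : ZMod 2) :
    signedAct cs (cs.wordProd ω) (t, ε) =
      (cs.wordProd ω * t * (cs.wordProd ω)⁻¹, ε + ((cs.rightInvSeq ω).count t : ℕ)) := by
  induction ω with
  | nil =>
    rw [cs.wordProd_nil, map_one, Function.End.one_def]
    simp
  | cons i ω ih =>
    rw [cs.wordProd_cons, signedAct_mul, ih, signedAct_simple]
    have e : (cs.wordProd ω * t * (cs.wordProd ω)⁻¹ = cs.simple i) ↔
        (cs.wordProd ω)⁻¹ * cs.simple i * cs.wordProd ω = t := by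
      rw [mul_inv_eq_iff_eq_mul, ← eq_inv_mul_iff_mul_eq, mul_assoc, eq_comm]
    refine Prod.ext ?_ ?_
    · simp [signedConj, mul_assoc]
    · simp only [signedConj, CoxeterSystem.rightInvSeq, List.count_cons, beq_iff_eq, e]
      split_ifs <;> push_cast <;> ring

lemma signedAct_fst (w t : W) (ε : ZMod 2) : (signedAct cs w (t, ε)).1 = w * t * w⁻¹ := by
  classical
  obtain ⟨ω, rfl⟩ := cs.wordProd_surjective w
  rw [signedAct_wordProd]

lemma signedAct_snd_add (w t : W) (ε : ZMod 2) :
    (signedAct cs w (t, ε)).2 = ε + (signedAct cs w (t, 0)).2 := by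
  classical
  obtain ⟨ω, rfl⟩ := cs.wordProd_surjective w
  simp [signedAct_wordProd]

lemma signedAct_eq (w t : W) (ε : ZMod 2) :
    signedAct cs w (t, ε) = (w * t * w⁻¹, ε + (signedAct cs w (t, 0)).2) :=
  Prod.ext (signedAct_fst cs w t ε) (signedAct_snd_add cs w t ε)

lemma signedAct_reflection {t : W} (ht : cs.IsReflection t) :
    (signedAct cs t (t, 0)).2 = 1 := by
  obtain ⟨u, i, rfl⟩ := ht
  set t := u * cs.simple i * u⁻¹ with ht
  have h1 : signedAct cs (u * u⁻¹) (t, 0) = (t, 0) := by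
    rw [mul_inv_cancel, map_one, Function.End.one_def]; rfl
  rw [signedAct_mul, signedAct_eq cs u⁻¹, signedAct_eq cs u] at h1
  have h2 := congrArg Prod.snd h1
  have e : u⁻¹ * t * u⁻¹⁻¹ = cs.simple i := by rw [ht]; group
  simp only [e, zero_add] at h2
  have h3 : signedAct cs t (t, 0) = signedAct cs (u * (cs.simple i * u⁻¹)) (t, 0) := by
    rw [← mul_assoc, ← ht]
  rw [h3, signedAct_mul, signedAct_mul, signedAct_eq cs u⁻¹, e, signedAct_simple]
  simp only [signedConj, CoxeterSystem.simple_mul_simple_self, one_mul, if_true, zero_add]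
  rw [signedAct_snd_add]
  linear_combination h2

lemma signedAct_mul_reflection (w : W) {t : W} (ht : cs.IsReflection t) :
    (signedAct cs (w * t) (t, 0)).2 = (signedAct cs w (t, 0)).2 + 1 := by
  have e : t * t * t⁻¹ = t := by group
  rw [signedAct_mul, signedAct_eq cs t, e, signedAct_reflection cs ht, signedAct_snd_add]
  ring

lemma mem_rightInvSeq_of_signedAct {ω : List B} {t : W}
    (h : (signedAct cs (cs.wordProd ω) (t, 0)).2 = 1) : t ∈ cs.rightInvSeq ω := by
  classical
  by_contra hn
  rw [signedAct_wordProd, List.count_eq_zero_of_not_mem hn] at h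
  simp at h

lemma length_mul_lt_of_signedAct {w t : W} (h : (signedAct cs w (t, 0)).2 = 1) :
    cs.length (w * t) < cs.length w := by
  obtain ⟨ω, hω, rfl⟩ := cs.exists_isReduced w
  exact (cs.isRightInversion_of_mem_rightInvSeq hω (mem_rightInvSeq_of_signedAct cs h)).2

/-- The parity of the number of occurrences of `t` in the inversion sequence of a word for `w`
depends only on `w`, and it is odd exactly when `t` is an inversion of `w`. -/
lemma signedAct_eq_one_iff {w t : W} (ht : cs.IsReflection t) :
    (signedAct cs w (t, 0)).2 = 1 ↔ cs.length (w * t) < cs.length w := by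
  refine ⟨length_mul_lt_of_signedAct cs, fun h => ?_⟩
  by_contra hn
  have h0 : (signedAct cs w (t, 0)).2 = 0 := by
    generalize (signedAct cs w (t, 0)).2 = x at hn
    revert x; decide
  have h1 := signedAct_mul_reflection cs w ht
  rw [h0, zero_add] at h1
  have h2 := length_mul_lt_of_signedAct cs h1
  rw [mul_assoc, ht.mul_self, mul_one] at h2
  exact absurd h2 (by lia)

theorem strong_exchange {t : W} (ht : cs.IsReflection t) {ω : List B}
    (h : cs.length (cs.wordProd ω * t) < cs.length (cs.wordProd ω)) :
    ∃ j < ω.length, cs.wordProd ω * t = cs.wordProd (ω.eraseIdx j) := by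
  have hm := mem_rightInvSeq_of_signedAct cs ((signedAct_eq_one_iff cs ht).mpr h)
  obtain ⟨j, hj, rfl⟩ := List.mem_iff_getElem.mp hm
  refine ⟨j, by simpa using hj, ?_⟩
  rw [← List.getD_eq_getElem _ 1 hj, cs.wordProd_mul_getD_rightInvSeq]

theorem exchange_left {i : B} {ω : List B} (h : cs.IsLeftDescent (cs.wordProd ω) i) :
    ∃ j < ω.length, cs.simple i * cs.wordProd ω = cs.wordProd (ω.eraseIdx j) := by
  have e : cs.wordProd ω * ((cs.wordProd ω)⁻¹ * cs.simple i * cs.wordProd ω) =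
      cs.simple i * cs.wordProd ω := by group
  have ht : cs.IsReflection ((cs.wordProd ω)⁻¹ * cs.simple i * cs.wordProd ω) :=
    ⟨(cs.wordProd ω)⁻¹, i, by rw [inv_inv]⟩
  obtain ⟨j, hj, h'⟩ := strong_exchange cs ht (ω := ω) (by rw [e]; exact h)
  exact ⟨j, hj, by rw [← e, h']⟩

theorem exists_reduced_sublist (ω : List B) :
    ∃ ω' : List B, ω'.Sublist ω ∧ cs.IsReduced ω' ∧ cs.wordProd ω' = cs.wordProd ω := by
  induction ω with
  | nil => exact ⟨[], List.Sublist.refl _, by simp [CoxeterSystem.IsReduced], rfl⟩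
  | cons i ω ih =>
    obtain ⟨ω', hs, hr, hp⟩ := ih
    by_cases hd : cs.IsLeftDescent (cs.wordProd ω') i
    · obtain ⟨j, hj, h⟩ := exchange_left cs hd
      refine ⟨ω'.eraseIdx j, ((List.eraseIdx_sublist ω' j).trans hs).trans
        (List.sublist_cons_self _ _), ?_, by rw [← h, cs.wordProd_cons, hp]⟩
      have h1 := cs.isLeftDescent_iff.mp hd
      have h2 := List.length_eraseIdx_add_one hj
      have h3 := hr.eq
      rw [CoxeterSystem.IsReduced, ← h]
      lia
    · refine ⟨i :: ω', hs.cons_cons i, ?_, by rw [cs.wordProd_cons, cs.wordProd_cons, hp]⟩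
      have h1 := cs.not_isLeftDescent_iff.mp hd
      have h3 := hr.eq
      rw [CoxeterSystem.IsReduced, cs.wordProd_cons, List.length_cons]
      lia

end Exchange

/-! ### Parabolic subgroups and minimal coset representatives -/

section Parabolic

variable {B W : Type*} [Group W] {M : CoxeterMatrix B} (cs : CoxeterSystem M W) {J : Set B}

lemma wordProd_mem_parabolic {ω : List B} (h : ∀ i ∈ ω, i ∈ J) :
    cs.wordProd ω ∈ parabolic cs J := by
  induction ω with
  | nil => simp
  | cons i ω ih =>
    rw [cs.wordProd_cons]
    exact Subgroup.mul_mem _ (Subgroup.subset_closure ⟨i, h i (by simp), rfl⟩)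
      (ih fun j hj => h j (by simp [hj]))

lemma exists_reduced_of_mem_parabolic {u : W} (hu : u ∈ parabolic cs J) :
    ∃ ω : List B, (∀ i ∈ ω, i ∈ J) ∧ cs.IsReduced ω ∧ u = cs.wordProd ω := by
  suffices h : ∃ ω : List B, (∀ i ∈ ω, i ∈ J) ∧ u = cs.wordProd ω by
    obtain ⟨ω, h1, rfl⟩ := h
    obtain ⟨ω', hs, hr, hp⟩ := exists_reduced_sublist cs ω
    exact ⟨ω', fun i hi => h1 i (hs.subset hi), hr, hp.symm⟩
  induction hu using Subgroup.closure_induction with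
  | mem x hx =>
    obtain ⟨i, hi, rfl⟩ := hx
    exact ⟨[i], by simpa using hi, by simp⟩
  | one => exact ⟨[], by simp, by simp⟩
  | mul x y _ _ hx hy =>
    obtain ⟨ω, h1, rfl⟩ := hx
    obtain ⟨ω', h2, rfl⟩ := hy
    refine ⟨ω ++ ω', fun i hi => ?_, by rw [cs.wordProd_append]⟩
    rcases List.mem_append.mp hi with h | h
    · exact h1 i h
    · exact h2 i h
  | inv x _ hx =>
    obtain ⟨ω, h1, rfl⟩ := hx
    exact ⟨ω.reverse, by simpa using h1, by simp⟩

/-- A left descent `i` of `ω b` deletes a letter from a word for it. Deleting one from `ω` is impossible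
if `i ω` is reduced, and deleting one from `b` gives an element of `W_J b` shorter than `b`. -/
lemma length_wordProd_mul_of_minimal {b : W}
    (hb : ∀ v ∈ parabolic cs J, cs.length b ≤ cs.length (v * b)) {ω : List B}
    (hω : ∀ i ∈ ω, i ∈ J) (hr : cs.IsReduced ω) :
    cs.length (cs.wordProd ω * b) = ω.length + cs.length b := by
  induction ω with
  | nil => simp
  | cons i ω ih =>
    have hω' : ∀ i ∈ ω, i ∈ J := fun j hj => hω j (by simp [hj])
    have hr' : cs.IsReduced ω := hr.drop 1
    have ih := ih hω' hr'
    obtain ⟨β, hβ, rfl⟩ := cs.exists_isReduced b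
    have key : ¬ cs.IsLeftDescent (cs.wordProd ω * cs.wordProd β) i := by
      intro hd
      rw [← cs.wordProd_append] at hd
      obtain ⟨j, hj, h⟩ := exchange_left cs hd
      rw [cs.wordProd_append] at h
      rcases Nat.lt_or_ge j ω.length with hlt | hge
      · rw [List.eraseIdx_append_of_lt_length hlt, cs.wordProd_append, ← mul_assoc] at h
        have h1 := mul_right_cancel h
        have h2 := hr.eq
        rw [cs.wordProd_cons, h1] at h2
        have h3 := cs.length_wordProd_le (ω.eraseIdx j)
        have h4 := List.length_eraseIdx_add_one hlt
        simp only [List.length_cons] at h2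
        lia
      · rw [List.eraseIdx_append_of_length_le hge, cs.wordProd_append] at h
        have h1 := hb ((cs.wordProd ω)⁻¹ * cs.simple i * cs.wordProd ω)
          (Subgroup.mul_mem _ (Subgroup.mul_mem _
            (Subgroup.inv_mem _ (wordProd_mem_parabolic cs hω'))
            (Subgroup.subset_closure ⟨i, hω i (by simp), rfl⟩)) (wordProd_mem_parabolic cs hω'))
        have h2 : (cs.wordProd ω)⁻¹ * cs.simple i * cs.wordProd ω * cs.wordProd β =
            cs.wordProd (β.eraseIdx (j - ω.length)) := by
          rw [mul_assoc, mul_assoc, h, inv_mul_cancel_left]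
        rw [h2] at h1
        rw [List.length_append] at hj
        have h3 := cs.length_wordProd_le (β.eraseIdx (j - ω.length))
        have h4 := List.length_eraseIdx_add_one (l := β) (i := j - ω.length) (by lia)
        have h5 := hβ.eq
        lia
    have h1 := cs.not_isLeftDescent_iff.mp key
    rw [cs.wordProd_cons, mul_assoc, h1, ih, List.length_cons]
    ring

variable (J) in
lemma exists_minimal_in_coset (w : W) : ∃ v ∈ parabolic cs J,
    ∀ u ∈ parabolic cs J, cs.length (v * w) ≤ cs.length (u * (v * w)) := by
  have hne : ((fun v : W => cs.length (v * w)) '' (parabolic cs J : Set W)).Nonempty :=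
    ⟨_, 1, Subgroup.one_mem _, rfl⟩
  obtain ⟨v, hv, he⟩ := Nat.sInf_mem hne
  refine ⟨v, hv, fun u hu => ?_⟩
  simp only at he
  rw [he, ← mul_assoc]
  exact Nat.sInf_le ⟨u * v, Subgroup.mul_mem _ hu hv, rfl⟩

lemma minimal_of_mem_minReps {a : W} (ha : a ∈ minReps cs J) :
    ∀ u ∈ parabolic cs J, cs.length a ≤ cs.length (u * a) := by
  obtain ⟨v, hv, hm⟩ := exists_minimal_in_coset cs J a
  obtain ⟨ω, hω, hr, he⟩ := exists_reduced_of_mem_parabolic cs (Subgroup.inv_mem _ hv)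
  have e : a = cs.wordProd ω * (v * a) := by rw [← he, inv_mul_cancel_left]
  rcases ω with _ | ⟨i, ω⟩
  · rw [cs.wordProd_nil, one_mul] at e
    rw [← e] at hm
    exact hm
  · exfalso
    apply ha i (hω i (by simp))
    have h1 := length_wordProd_mul_of_minimal cs hm hω hr
    have h2 := length_wordProd_mul_of_minimal cs hm (ω := ω)
      (fun j hj => hω j (by simp [hj])) (hr.drop 1)
    rw [← e] at h1
    have e2 : cs.simple i * a = cs.wordProd ω * (v * a) := by
      nth_rw 1 [e]
      rw [cs.wordProd_cons, mul_assoc, cs.simple_mul_simple_cancel_left]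
    rw [CoxeterSystem.IsLeftDescent, e2, h2, h1, List.length_cons]
    lia

/-- Lengths add in the decomposition `W = W_J W^J`. -/
theorem length_mul_of_mem_minReps {u a : W} (hu : u ∈ parabolic cs J) (ha : a ∈ minReps cs J) :
    cs.length (u * a) = cs.length u + cs.length a := by
  obtain ⟨ω, hω, hr, rfl⟩ := exists_reduced_of_mem_parabolic cs hu
  rw [length_wordProd_mul_of_minimal cs (minimal_of_mem_minReps cs ha) hω hr, hr.eq]

variable (J) in
theorem exists_parabolic_mul_minReps (w : W) :
    ∃ u ∈ parabolic cs J, ∃ a ∈ minReps cs J, w = u * a := by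
  obtain ⟨v, hv, hm⟩ := exists_minimal_in_coset cs J w
  refine ⟨v⁻¹, Subgroup.inv_mem _ hv, v * w, fun i hi hd => ?_, by group⟩
  have := hm (cs.simple i) (Subgroup.subset_closure ⟨i, hi, rfl⟩)
  exact absurd hd (by rw [CoxeterSystem.IsLeftDescent]; lia)

theorem minReps_unique {u u' a a' : W} (hu : u ∈ parabolic cs J) (hu' : u' ∈ parabolic cs J)
    (ha : a ∈ minReps cs J) (ha' : a' ∈ minReps cs J) (h : u * a = u' * a') : u = u' ∧ a = a' := by
  have hv : u'⁻¹ * u ∈ parabolic cs J := Subgroup.mul_mem _ (Subgroup.inv_mem _ hu') hu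
  have e : a' = u'⁻¹ * u * a := by rw [mul_assoc, h, inv_mul_cancel_left]
  have h1 := length_mul_of_mem_minReps cs hv ha
  have h2 := minimal_of_mem_minReps cs ha' _ (Subgroup.inv_mem _ hv)
  rw [← e] at h1
  have e2 : (u'⁻¹ * u)⁻¹ * a' = a := by rw [e]; group
  rw [e2] at h2
  have h3 : u'⁻¹ * u = 1 := by rw [← cs.length_eq_zero_iff]; lia
  refine ⟨(inv_mul_eq_one.mp h3).symm, by rw [e, h3, one_mul]⟩

lemma isLeftDescent_mul_iff {u a : W} (hu : u ∈ parabolic cs J) (ha : a ∈ minReps cs J) {i : B}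
    (hi : i ∈ J) : cs.IsLeftDescent (u * a) i ↔ cs.IsLeftDescent u i := by
  have h : cs.simple i * u ∈ parabolic cs J :=
    Subgroup.mul_mem _ (Subgroup.subset_closure ⟨i, hi, rfl⟩) hu
  rw [CoxeterSystem.IsLeftDescent, CoxeterSystem.IsLeftDescent, ← mul_assoc,
    length_mul_of_mem_minReps cs hu ha, length_mul_of_mem_minReps cs h ha]
  lia

end Parabolic

/-! ### Bruhat order -/

section Bruhat

variable {B W : Type*} [Group W] {M : CoxeterMatrix B} (cs : CoxeterSystem M W)

lemma BruhatLE.length_le {y w : W} (h : BruhatLE cs y w) : cs.length y ≤ cs.length w := by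
  induction h with
  | refl => exact le_rfl
  | tail _ h ih => exact ih.trans h.1.le

lemma BruhatLE.length_lt {y w : W} (h : BruhatLE cs y w) (hne : y ≠ w) :
    cs.length y < cs.length w := by
  rcases Relation.ReflTransGen.cases_tail h with rfl | ⟨z, h1, h2⟩
  · exact absurd rfl hne
  · exact lt_of_le_of_lt (BruhatLE.length_le cs h1) h2.1

lemma BruhatLE.trans {x y z : W} (h : BruhatLE cs x y) (h' : BruhatLE cs y z) :
    BruhatLE cs x z := Relation.ReflTransGen.trans h h'

lemma bruhatLE_simple_mul {w : W} {i : B} (h : ¬ cs.IsLeftDescent w i) :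
    BruhatLE cs w (cs.simple i * w) := by
  refine Relation.ReflTransGen.single ⟨?_, w⁻¹ * cs.simple i * w,
    ⟨w⁻¹, i, by rw [inv_inv]⟩, by group⟩
  have := cs.not_isLeftDescent_iff.mp h
  lia

/-- Left multiplication by a simple reflection preserves an edge of the Bruhat graph or collapses
it. -/
lemma bruhatLE_simple_mul_edge {v t : W} (ht : cs.IsReflection t)
    (h : cs.length v < cs.length (v * t)) (i : B) :
    BruhatLE cs (cs.simple i * v) (cs.simple i * (v * t)) ∨ cs.simple i * v = v * t := by
  rcases lt_or_gt_of_ne (ht.length_mul_left_ne (cs.simple i * v)) with hlt | hgt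
  · right
    obtain ⟨ω, hω, rfl⟩ := cs.exists_isReduced v
    rw [← cs.wordProd_cons] at hlt
    obtain ⟨j, hj, he⟩ := strong_exchange cs ht hlt
    rcases j with _ | j
    · simp only [List.eraseIdx_cons_zero] at he
      rw [← cs.wordProd_cons, ← he, mul_assoc, ht.mul_self, mul_one]
    · exfalso
      simp only [List.eraseIdx_cons_succ, cs.wordProd_cons, mul_assoc] at he
      rw [mul_left_cancel he] at h
      have h1 := cs.length_wordProd_le (ω.eraseIdx j)
      have h2 := List.length_eraseIdx_add_one (l := ω) (i := j) (by simpa using hj)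
      have h3 := hω.eq
      lia
  · left
    exact Relation.ReflTransGen.single ⟨by rw [← mul_assoc]; exact hgt, t, ht, by rw [mul_assoc]⟩

lemma bruhatLE_simple_mul_or {x w : W} (h : BruhatLE cs x w) (i : B) :
    BruhatLE cs (cs.simple i * x) w ∨ BruhatLE cs (cs.simple i * x) (cs.simple i * w) := by
  induction h with
  | refl => exact Or.inr Relation.ReflTransGen.refl
  | @tail v w _ hvw ih =>
    have hvw' : BruhatLE cs v w := Relation.ReflTransGen.single hvw
    obtain ⟨hl, t, ht, rfl⟩ := hvw
    rcases ih with ih | ih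
    · exact Or.inl (ih.trans cs hvw')
    · rcases bruhatLE_simple_mul_edge cs ht hl i with h | h
      · exact Or.inr (ih.trans cs h)
      · exact Or.inl (h ▸ ih)

lemma bruhatLE_of_simple_mul {x w : W} {i : B} (hw : ¬ cs.IsLeftDescent w i)
    (h : BruhatLE cs (cs.simple i * x) w) : BruhatLE cs x (cs.simple i * w) := by
  rcases bruhatLE_simple_mul_or cs h i with h' | h' <;>
    rw [cs.simple_mul_simple_cancel_left] at h'
  · exact h'.trans cs (bruhatLE_simple_mul cs hw)
  · exact h'

/-- Passing to minimal coset representatives is monotone for the Bruhat order, here in the weak form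
that the lengths of the representatives do not decrease, with equality only inside a coset. -/
lemma minReps_of_bruhatLE {J : Set B} {x z : W} (h : BruhatLE cs x z) :
    ∀ {u v b c : W}, u ∈ parabolic cs J → v ∈ parabolic cs J → b ∈ minReps cs J →
      c ∈ minReps cs J → x = u * b → z = v * c → b = c ∨ cs.length b < cs.length c := by
  induction h with
  | refl =>
    intro u v b c hu hv hb hc h1 h2
    exact Or.inl (minReps_unique cs hu hv hb hc (h1.symm.trans h2)).2
  | @tail y z _ hyz ih =>
    intro u v b c hu hv hb hc h1 h2
    obtain ⟨u', hu', b', hb', hy⟩ := exists_parabolic_mul_minReps cs J y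
    suffices key : b' = c ∨ cs.length b' < cs.length c by
      rcases ih hu hu' hb hb' h1 hy with rfl | h
      · exact key
      · rcases key with rfl | h'
        · exact Or.inr h
        · exact Or.inr (h.trans h')
    obtain ⟨hl, t, ht, rfl⟩ := hyz
    obtain ⟨ν, hν, hνr, rfl⟩ := exists_reduced_of_mem_parabolic cs hv
    obtain ⟨γ, hγ, rfl⟩ := cs.exists_isReduced c
    rw [← cs.wordProd_append] at h2
    have hy2 : cs.wordProd (ν ++ γ) * t = y := by
      rw [← h2, mul_assoc, ht.mul_self, mul_one]
    obtain ⟨j, hj, he⟩ := strong_exchange cs ht (ω := ν ++ γ) (by rw [hy2, ← h2]; exact hl)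
    rw [hy2] at he
    -- a letter deleted from `ν` does not change the coset, one deleted from `γ` gives a coset
    -- with a shorter representative
    rcases Nat.lt_or_ge j ν.length with hlt | hge
    · rw [List.eraseIdx_append_of_lt_length hlt, cs.wordProd_append] at he
      left
      refine (minReps_unique cs hu' (wordProd_mem_parabolic cs fun i hi => hν i ?_) hb' hc
        (hy.symm.trans he)).2
      exact (List.eraseIdx_sublist ν j).subset hi
    · right
      rw [List.eraseIdx_append_of_length_le hge, cs.wordProd_append] at he
      have h3 := minimal_of_mem_minReps cs hb' ((cs.wordProd ν)⁻¹ * u')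
        (Subgroup.mul_mem _ (Subgroup.inv_mem _ hv) hu')
      have h4 : (cs.wordProd ν)⁻¹ * u' * b' = cs.wordProd (γ.eraseIdx (j - ν.length)) := by
        have : u' * b' = cs.wordProd ν * cs.wordProd (γ.eraseIdx (j - ν.length)) :=
          hy.symm.trans he
        rw [mul_assoc, this, inv_mul_cancel_left]
      rw [h4] at h3
      rw [List.length_append] at hj
      have h5 := cs.length_wordProd_le (γ.eraseIdx (j - ν.length))
      have h6 := List.length_eraseIdx_add_one (l := γ) (i := j - ν.length) (by lia)
      have h7 := hγ.eq
      lia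

end Bruhat

/-! ### The regular representation of the Hecke algebra -/

section Regular

variable {B W : Type*} [Group W] {M : CoxeterMatrix B} (cs : CoxeterSystem M W)
  {R : Type*} [CommRing R] (q : R)

open Classical in
/-- Left multiplication by `T_s` on the free `R`-module with basis `T_w`, with parameter `q`. -/
noncomputable def leftMul (i : B) : Module.End R (W →₀ R) :=
  Finsupp.linearCombination R (fun w : W =>
    if cs.IsLeftDescent w i then
      Finsupp.single w (q - 1) + Finsupp.single (cs.simple i * w) q
    else Finsupp.single (cs.simple i * w) 1)

open Classical in
/-- Right multiplication by `T_s` on the free `R`-module with basis `T_w`, with parameter `q`. -/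
noncomputable def rightMul (i : B) : Module.End R (W →₀ R) :=
  Finsupp.linearCombination R (fun w : W =>
    if cs.IsRightDescent w i then
      Finsupp.single w (q - 1) + Finsupp.single (w * cs.simple i) q
    else Finsupp.single (w * cs.simple i) 1)

lemma heckeGen_eq_leftMul (i : B) : heckeGen cs i = leftMul cs qVar i := rfl

open Classical in
lemma leftMul_apply (i : B) (h : W →₀ R) (x : W) :
    leftMul cs q i h x = if cs.IsLeftDescent x i then (q - 1) * h x + h (cs.simple i * x)
      else q * h (cs.simple i * x) := by
  induction h using Finsupp.induction_linear with
  | zero => simp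
  | add f g hf hg =>
    rw [map_add, Finsupp.add_apply, hf, hg]
    split_ifs <;> simp only [Finsupp.add_apply] <;> ring
  | single w c =>
    have e : cs.simple i * w = x ↔ w = cs.simple i * x := by
      constructor <;> rintro rfl <;> simp
    have e2 : cs.IsLeftDescent (cs.simple i * x) i ↔ ¬ cs.IsLeftDescent x i := by
      rw [cs.isLeftDescent_iff_not_isLeftDescent_mul, cs.simple_mul_simple_cancel_left]
    have e3 : x ≠ cs.simple i * x := fun h => cs.length_simple_mul_ne x i (by rw [← h])
    rw [leftMul, Finsupp.linearCombination_single]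
    by_cases h1 : w = x
    · subst h1
      by_cases h2 : cs.IsLeftDescent w i <;> simp [h2, e3, e3.symm, mul_comm]
    · by_cases h3 : w = cs.simple i * x
      · subst h3
        by_cases h2 : cs.IsLeftDescent x i <;> simp [h2, e2, e3.symm, mul_comm]
      · by_cases h2 : cs.IsLeftDescent w i <;>
          simp [h2, e, h3, h1]

open Classical in
lemma rightMul_apply (i : B) (h : W →₀ R) (x : W) :
    rightMul cs q i h x = if cs.IsRightDescent x i then (q - 1) * h x + h (x * cs.simple i)
      else q * h (x * cs.simple i) := by
  induction h using Finsupp.induction_linear with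
  | zero => simp
  | add f g hf hg =>
    rw [map_add, Finsupp.add_apply, hf, hg]
    split_ifs <;> simp only [Finsupp.add_apply] <;> ring
  | single w c =>
    have e : w * cs.simple i = x ↔ w = x * cs.simple i := by
      constructor <;> rintro rfl <;> simp
    have e2 : cs.IsRightDescent (x * cs.simple i) i ↔ ¬ cs.IsRightDescent x i := by
      rw [cs.isRightDescent_iff_not_isRightDescent_mul, cs.simple_mul_simple_cancel_right]
    have e3 : x ≠ x * cs.simple i := fun h => cs.length_mul_simple_ne x i (by rw [← h])
    rw [rightMul, Finsupp.linearCombination_single]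
    by_cases h1 : w = x
    · subst h1
      by_cases h2 : cs.IsRightDescent w i <;> simp [h2, e3, e3.symm, mul_comm]
    · by_cases h3 : w = x * cs.simple i
      · subst h3
        by_cases h2 : cs.IsRightDescent x i <;> simp [h2, e2, e3.symm, mul_comm]
      · by_cases h2 : cs.IsRightDescent w i <;>
          simp [h2, e, h3, h1]

lemma leftMul_single {w : W} {i : B} (h : ¬ cs.IsLeftDescent w i) :
    leftMul cs q i (Finsupp.single w 1) = Finsupp.single (cs.simple i * w) 1 := by
  simp [leftMul, h]

lemma rightMul_single {w : W} {i : B} (h : ¬ cs.IsRightDescent w i) :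
    rightMul cs q i (Finsupp.single w 1) = Finsupp.single (w * cs.simple i) 1 := by
  simp [rightMul, h]

/-- If `j` becomes a right descent by left multiplication with `s_i`, then `s_i x = x s_j`. -/
lemma simple_mul_eq_mul_simple {x : W} {i j : B} (h1 : ¬ cs.IsRightDescent x j)
    (h2 : cs.IsRightDescent (cs.simple i * x) j) : cs.simple i * x = x * cs.simple j := by
  have h3 := cs.not_isRightDescent_iff.mp h1
  rcases bruhatLE_simple_mul_edge cs (cs.isReflection_simple j) (v := x) (by lia) i with h | h
  · have h4 := BruhatLE.length_le cs h
    rw [← mul_assoc] at h4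
    exact absurd h2 (by rw [CoxeterSystem.IsRightDescent]; lia)
  · exact h

lemma isRightDescent_simple_mul_iff {x : W} {i j : B} (h : cs.simple i * x ≠ x * cs.simple j) :
    cs.IsRightDescent (cs.simple i * x) j ↔ cs.IsRightDescent x j := by
  by_contra hn
  by_cases h1 : cs.IsRightDescent x j
  · have h2 : ¬ cs.IsRightDescent (cs.simple i * x) j := by tauto
    have h3 := simple_mul_eq_mul_simple cs (i := i) h2
      (by rwa [cs.simple_mul_simple_cancel_left])
    rw [cs.simple_mul_simple_cancel_left] at h3
    apply h
    nth_rw 2 [h3]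
    rw [cs.simple_mul_simple_cancel_right]
  · exact h (simple_mul_eq_mul_simple cs h1 (by tauto))

lemma isLeftDescent_mul_simple_iff {x : W} {i j : B} (h : cs.simple i * x ≠ x * cs.simple j) :
    cs.IsLeftDescent (x * cs.simple j) i ↔ cs.IsLeftDescent x i := by
  rw [← cs.isRightDescent_inv_iff, ← cs.isRightDescent_inv_iff (w := x), mul_inv_rev,
    cs.inv_simple]
  apply isRightDescent_simple_mul_iff
  intro h'
  apply h
  have := congrArg (·⁻¹) h'
  simpa using this.symm

lemma leftMul_rightMul_comm (i j : B) :
    leftMul cs q i * rightMul cs q j = rightMul cs q j * leftMul cs q i := by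
  classical
  refine LinearMap.ext fun h => Finsupp.ext fun x => ?_
  simp only [Module.End.mul_apply, leftMul_apply, rightMul_apply]
  by_cases hx : cs.simple i * x = x * cs.simple j
  · have h1 : cs.IsLeftDescent x i ↔ cs.IsRightDescent x j := by
      rw [CoxeterSystem.IsLeftDescent, CoxeterSystem.IsRightDescent, hx]
    have h2 : cs.IsRightDescent (x * cs.simple j) j ↔ ¬ cs.IsRightDescent x j := by
      rw [cs.isRightDescent_iff_not_isRightDescent_mul, cs.simple_mul_simple_cancel_right]
    have h3 : cs.IsLeftDescent (x * cs.simple j) i ↔ ¬ cs.IsRightDescent x j := by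
      rw [← hx, cs.isLeftDescent_iff_not_isLeftDescent_mul, cs.simple_mul_simple_cancel_left, h1]
    have h4 : cs.simple i * (x * cs.simple j) = x := by
      rw [← hx, cs.simple_mul_simple_cancel_left]
    simp only [hx, h1, h2, h3, h4, cs.simple_mul_simple_cancel_right]
  · simp only [isRightDescent_simple_mul_iff cs hx, isLeftDescent_mul_simple_iff cs hx, mul_assoc]
    split_ifs <;> ring

/-- An operator that commutes with the right multiplications is determined by its value at `T_1`. -/
lemma eq_of_commute_rightMul {A A' : Module.End R (W →₀ R)}
    (hA : ∀ j, A * rightMul cs q j = rightMul cs q j * A)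
    (hA' : ∀ j, A' * rightMul cs q j = rightMul cs q j * A')
    (h : A (Finsupp.single 1 1) = A' (Finsupp.single 1 1)) : A = A' := by
  suffices key : ∀ n, ∀ w : W, cs.length w = n →
      A (Finsupp.single w 1) = A' (Finsupp.single w 1) by
    refine Finsupp.lhom_ext fun w c => ?_
    rw [← mul_one c, ← smul_eq_mul, ← Finsupp.smul_single, map_smul, map_smul, key _ w rfl]
  intro n
  induction n with
  | zero =>
    intro w hw
    rw [cs.length_eq_zero_iff.mp hw, h]
  | succ n ih =>
    intro w hw
    have hne : w ≠ 1 := by rintro rfl; simp at hw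
    obtain ⟨j, hj⟩ := cs.exists_rightDescent_of_ne_one hne
    have h1 := cs.isRightDescent_iff.mp hj
    have h2 := cs.isRightDescent_iff_not_isRightDescent_mul.mp hj
    have h3 := rightMul_single cs q h2
    rw [cs.simple_mul_simple_cancel_right] at h3
    rw [← h3, ← Module.End.mul_apply, ← Module.End.mul_apply, hA, hA', Module.End.mul_apply,
      Module.End.mul_apply, ih _ (by lia)]

lemma wordProd_leftMul_commute (ω : List B) (j : B) :
    (ω.map (leftMul cs q)).prod * rightMul cs q j =
      rightMul cs q j * (ω.map (leftMul cs q)).prod := by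
  induction ω with
  | nil => simp
  | cons i ω ih =>
    rw [List.map_cons, List.prod_cons, mul_assoc, ih, ← mul_assoc, leftMul_rightMul_comm,
      mul_assoc]

lemma wordProd_leftMul_single {ω : List B} (hω : cs.IsReduced ω) :
    (ω.map (leftMul cs q)).prod (Finsupp.single 1 1) = Finsupp.single (cs.wordProd ω) 1 := by
  induction ω with
  | nil => simp
  | cons i ω ih =>
    have h1 : cs.IsReduced ω := hω.drop 1
    have h2 : ¬ cs.IsLeftDescent (cs.wordProd ω) i := by
      rw [cs.not_isLeftDescent_iff, ← cs.wordProd_cons, hω.eq, h1.eq, List.length_cons]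
    rw [List.map_cons, List.prod_cons, Module.End.mul_apply, ih h1, leftMul_single cs q h2,
      cs.wordProd_cons]

/-- The operator `T_w` does not depend on the reduced word of `w` used to define it. -/
lemma wordProd_leftMul_eq {ω ω' : List B} (hω : cs.IsReduced ω) (hω' : cs.IsReduced ω')
    (h : cs.wordProd ω = cs.wordProd ω') :
    (ω.map (leftMul cs q)).prod = (ω'.map (leftMul cs q)).prod :=
  eq_of_commute_rightMul cs q (wordProd_leftMul_commute cs q ω) (wordProd_leftMul_commute cs q ω')
    (by rw [wordProd_leftMul_single cs q hω, wordProd_leftMul_single cs q hω', h])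

lemma leftMul_mul_self (i : B) :
    leftMul cs q i * leftMul cs q i = (q - 1) • leftMul cs q i + q • 1 := by
  classical
  refine LinearMap.ext fun h => Finsupp.ext fun x => ?_
  have e2 : cs.IsLeftDescent (cs.simple i * x) i ↔ ¬ cs.IsLeftDescent x i := by
    rw [cs.isLeftDescent_iff_not_isLeftDescent_mul, cs.simple_mul_simple_cancel_left]
  simp only [Module.End.mul_apply, LinearMap.add_apply, LinearMap.smul_apply, Module.End.one_apply,
    Finsupp.add_apply, Finsupp.smul_apply, smul_eq_mul, leftMul_apply, e2,
    cs.simple_mul_simple_cancel_left]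
  by_cases h2 : cs.IsLeftDescent x i
  · simp only [h2, if_true, if_false, not_true]
  · simp only [h2, if_false, if_true, not_false_iff]
    ring

lemma leftMul_mapRange {R' : Type*} [CommRing R'] (f : R →+* R') (i : B) (h : W →₀ R) :
    leftMul cs (f q) i (h.mapRange f (map_zero f)) =
      (leftMul cs q i h).mapRange f (map_zero f) := by
  classical
  ext x
  simp only [leftMul_apply, Finsupp.mapRange_apply]
  split_ifs <;> simp

end Regular

/-! ### The bar involution -/

section Bar

variable {B W : Type*} [Group W] {M : CoxeterMatrix B} (cs : CoxeterSystem M W)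

lemma T_neg_one_mul_qVar : (LaurentPolynomial.T (-1) : ℤ[T;T⁻¹]) * qVar = 1 := by
  rw [qVar, ← LaurentPolynomial.T_add]; simp

lemma heckeGenInv_mul_heckeGen (i : B) : heckeGenInv cs i * heckeGen cs i = 1 := by
  rw [heckeGenInv, add_mul, smul_mul_assoc, smul_mul_assoc, one_mul, heckeGen_eq_leftMul,
    leftMul_mul_self, smul_add, smul_smul, smul_smul, T_neg_one_mul_qVar, one_smul,
    add_right_comm, ← add_smul]
  have : (LaurentPolynomial.T (-1) : ℤ[T;T⁻¹]) * (qVar - 1) +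
      (LaurentPolynomial.T (-1) - 1) = 0 := by
    linear_combination T_neg_one_mul_qVar
  rw [this, zero_smul, zero_add]

lemma heckeGen_mul_heckeGenInv (i : B) : heckeGen cs i * heckeGenInv cs i = 1 := by
  have : heckeGen cs i * heckeGenInv cs i = heckeGenInv cs i * heckeGen cs i := by
    rw [heckeGenInv, add_mul, mul_add, smul_mul_assoc, smul_mul_assoc, mul_smul_comm,
      mul_smul_comm, one_mul, mul_one]
  rw [this, heckeGenInv_mul_heckeGen]

lemma wordProd_heckeGenInv_mul (ω : List B) :
    (ω.map (heckeGenInv cs)).prod * (ω.reverse.map (heckeGen cs)).prod = 1 := by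
  induction ω with
  | nil => simp
  | cons i ω ih =>
    rw [List.map_cons, List.prod_cons, List.reverse_cons, List.map_append, List.prod_append]
    simp only [List.map_cons, List.map_nil, List.prod_singleton]
    rw [mul_assoc, ← mul_assoc _ _ (heckeGen cs i), ih, one_mul, heckeGenInv_mul_heckeGen]

lemma heckeGen_wordProd_mul (ω : List B) :
    (ω.reverse.map (heckeGen cs)).prod * (ω.map (heckeGenInv cs)).prod = 1 := by
  induction ω with
  | nil => simp
  | cons i ω ih =>
    rw [List.map_cons, List.prod_cons, List.reverse_cons, List.map_append, List.prod_append]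
    simp only [List.map_cons, List.map_nil, List.prod_singleton]
    rw [mul_assoc, ← mul_assoc (heckeGen cs i), heckeGen_mul_heckeGenInv, one_mul, ih]

/-- The element `bar T_w` may be computed from any reduced word of `w`. -/
lemma barBasis_eq {ω : List B} (hω : cs.IsReduced ω) :
    barBasis cs (cs.wordProd ω) = (ω.map (heckeGenInv cs)).prod (Finsupp.single 1 1) := by
  have h := (cs.exists_isReduced (cs.wordProd ω)).choose_spec
  change cs.IsReduced (redWord cs _) ∧ _ = cs.wordProd (redWord cs _) at h
  obtain ⟨h1, h2⟩ := h
  rw [barBasis]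
  generalize redWord cs (cs.wordProd ω) = ω' at h1 h2
  have h3 : (ω.reverse.map (heckeGen cs)).prod = (ω'.reverse.map (heckeGen cs)).prod :=
    wordProd_leftMul_eq cs qVar hω.reverse h1.reverse (by simp [h2])
  have h4 := heckeGen_wordProd_mul cs ω'
  rw [← h3] at h4
  rw [left_inv_eq_right_inv (wordProd_heckeGenInv_mul cs ω) h4]

lemma barBasis_one : barBasis cs 1 = Finsupp.single 1 1 := by
  have := barBasis_eq cs (ω := []) (by simp [CoxeterSystem.IsReduced])
  simpa using this

lemma barBasis_simple_mul {w : W} {i : B} (h : ¬ cs.IsLeftDescent w i) :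
    barBasis cs (cs.simple i * w) = heckeGenInv cs i (barBasis cs w) := by
  obtain ⟨ω, hω, rfl⟩ := cs.exists_isReduced w
  have h1 : cs.IsReduced (i :: ω) := by
    rw [CoxeterSystem.IsReduced, cs.wordProd_cons, cs.not_isLeftDescent_iff.mp h, hω.eq,
      List.length_cons]
  rw [← cs.wordProd_cons, barBasis_eq cs h1, barBasis_eq cs hω, List.map_cons, List.prod_cons,
    Module.End.mul_apply]

lemma bar_single (w : W) (c : ℤ[T;T⁻¹]) :
    bar cs (Finsupp.single w c) = LaurentPolynomial.invert c • barBasis cs w := by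
  rw [bar, Finsupp.sum_single_index]; simp

lemma bar_zero : bar cs (0 : Hecke W) = 0 := by simp [bar]

lemma bar_add (g h : Hecke W) : bar cs (g + h) = bar cs g + bar cs h := by
  classical
  rw [bar, Finsupp.sum_add_index] <;> simp [bar, add_smul]

lemma bar_smul (c : ℤ[T;T⁻¹]) (h : Hecke W) :
    bar cs (c • h) = LaurentPolynomial.invert c • bar cs h := by
  induction h using Finsupp.induction_linear with
  | zero => simp [bar_zero]
  | add f g hf hg => rw [smul_add, bar_add, bar_add, hf, hg, smul_add]
  | single w a => rw [Finsupp.smul_single, bar_single, bar_single, smul_eq_mul, map_mul, mul_smul]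

lemma bar_sub (g h : Hecke W) : bar cs (g - h) = bar cs g - bar cs h := by
  rw [eq_sub_iff_add_eq, ← bar_add, sub_add_cancel]

lemma bar_sum {ι : Type*} (s : Finset ι) (f : ι → Hecke W) :
    bar cs (∑ k ∈ s, f k) = ∑ k ∈ s, bar cs (f k) := by
  classical
  induction s using Finset.induction_on with
  | empty => simp [bar_zero]
  | insert a s ha ih => rw [Finset.sum_insert ha, Finset.sum_insert ha, bar_add, ih]

lemma bar_heckeGen (i : B) (h : Hecke W) :
    bar cs (heckeGen cs i h) = heckeGenInv cs i (bar cs h) := by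
  induction h using Finsupp.induction_linear with
  | zero => simp [bar_zero]
  | add f g hf hg => rw [map_add, bar_add, bar_add, hf, hg, map_add]
  | single w c =>
    rw [← mul_one c, ← smul_eq_mul, ← Finsupp.smul_single, map_smul, bar_smul, bar_smul, map_smul]
    congr 1
    rw [bar_single, map_one, one_smul]
    by_cases hd : cs.IsLeftDescent w i
    · have hd' := cs.isLeftDescent_iff_not_isLeftDescent_mul.mp hd
      obtain ⟨v, rfl⟩ : ∃ v, w = cs.simple i * v :=
        ⟨cs.simple i * w, by rw [cs.simple_mul_simple_cancel_left]⟩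
      rw [cs.simple_mul_simple_cancel_left] at hd'
      have h1 : heckeGen cs i (Finsupp.single (cs.simple i * v) 1) =
          heckeGen cs i (heckeGen cs i (Finsupp.single v 1)) := by
        rw [heckeGen_eq_leftMul, leftMul_single cs _ hd']
      have h2 : heckeGen cs i (heckeGen cs i (Finsupp.single v 1)) =
          (qVar - 1) • Finsupp.single (cs.simple i * v) 1 + qVar • Finsupp.single v 1 := by
        rw [← Module.End.mul_apply, heckeGen_eq_leftMul, leftMul_mul_self]
        simp [leftMul_single cs _ hd']
      have h3 : heckeGen cs i (heckeGenInv cs i (barBasis cs v)) = barBasis cs v := by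
        rw [← Module.End.mul_apply, heckeGen_mul_heckeGenInv, Module.End.one_apply]
      rw [h1, h2, bar_add, bar_smul, bar_smul, bar_single, bar_single, map_one, one_smul, one_smul,
        barBasis_simple_mul cs hd']
      nth_rw 2 [heckeGenInv]
      rw [LinearMap.add_apply, LinearMap.smul_apply, LinearMap.smul_apply, Module.End.one_apply, h3]
      simp only [qVar, map_sub, LaurentPolynomial.invert_T, map_one]
      abel
    · rw [heckeGen_eq_leftMul, leftMul_single cs _ hd, bar_single, map_one, one_smul,
        barBasis_simple_mul cs hd]

open Classical in
lemma heckeGenInv_apply (i : B) (h : Hecke W) (x : W) :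
    heckeGenInv cs i h x = if cs.IsLeftDescent x i then
      LaurentPolynomial.T (-1) * h (cs.simple i * x)
      else h (cs.simple i * x) + (LaurentPolynomial.T (-1) - 1) * h x := by
  have e := T_neg_one_mul_qVar
  simp only [heckeGenInv, LinearMap.add_apply, LinearMap.smul_apply, Module.End.one_apply,
    Finsupp.add_apply, Finsupp.smul_apply, smul_eq_mul, heckeGen_eq_leftMul, leftMul_apply]
  split_ifs
  · linear_combination (h x) * e
  · linear_combination (h (cs.simple i * x)) * e

open Classical in
/-- `bar T_w` is `q^{-l(w)} T_w` plus a combination of the `T_x` with `l(x) < l(w)`. -/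
lemma barBasis_apply {w x : W} (h : cs.length w ≤ cs.length x) :
    barBasis cs w x = if x = w then LaurentPolynomial.T (-(cs.length w : ℤ)) else 0 := by
  obtain ⟨ω, hω, rfl⟩ := cs.exists_isReduced w
  rw [barBasis_eq cs hω]
  induction ω generalizing x with
  | nil => simp [Finsupp.single_apply, eq_comm]
  | cons i ω ih =>
    have h1 : cs.IsReduced ω := hω.drop 1
    have hl := hω.eq
    rw [List.length_cons] at hl
    have hl1 := h1.eq
    rw [hl] at h
    rw [List.map_cons, List.prod_cons, Module.End.mul_apply, heckeGenInv_apply]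
    have e : x = cs.wordProd (i :: ω) ↔ cs.simple i * x = cs.wordProd ω := by
      rw [cs.wordProd_cons]
      constructor
      · rintro rfl; simp
      · intro h; rw [← h]; simp
    split_ifs with hd hx hx
    · have hd' := cs.isLeftDescent_iff.mp hd
      rw [ih h1 (by lia), if_pos (e.mp hx), ← LaurentPolynomial.T_add, hl, hl1]
      push_cast; ring_nf
    · have hd' := cs.isLeftDescent_iff.mp hd
      rw [ih h1 (by lia), if_neg (fun h => hx (e.mpr h)), mul_zero]
    · have hd' := cs.not_isLeftDescent_iff.mp hd
      rw [e.mp hx] at hd'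
      lia
    · have hd' := cs.not_isLeftDescent_iff.mp hd
      rw [ih h1 (by lia), ih h1 (by lia), if_neg (fun h => hx (e.mpr h)), if_neg]
      · simp
      · rintro rfl; lia

end Bar

/-! ### Kazhdan-Lusztig polynomials -/

section KL

open Polynomial

section ToHecke

variable {W : Type*}

/-- The element `∑ P_y T_y` of the Hecke algebra. -/
noncomputable abbrev toHecke (P : W →₀ ℤ[X]) : Hecke W := P.mapRange toLaurent (map_zero _)

lemma toHecke_sub (P Q : W →₀ ℤ[X]) : toHecke (P - Q) = toHecke P - toHecke Q := by
  ext x : 1; simp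

lemma toHecke_sum {ι : Type*} (s : Finset ι) (P : ι → W →₀ ℤ[X]) :
    toHecke (∑ k ∈ s, P k) = ∑ k ∈ s, toHecke (P k) := by
  ext x : 1
  simp [Finsupp.finsetSum_apply]

lemma toHecke_smul (c : ℤ[X]) (P : W →₀ ℤ[X]) : toHecke (c • P) = toLaurent c • toHecke P := by
  ext x : 1; simp

end ToHecke

variable {B W : Type*} [Group W] {M : CoxeterMatrix B} (cs : CoxeterSystem M W)

/-- The degree condition on Kazhdan-Lusztig polynomials, in terms of coefficients. -/
lemma isKLFamily_iff {w : W} {P : W →₀ ℤ[X]} :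
    IsKLFamily cs w P ↔ (∀ y, P y ≠ 0 → BruhatLE cs y w) ∧ P w = 1 ∧
      (∀ y ≠ w, ∀ k, cs.length w ≤ 2 * k + cs.length y → (P y).coeff k = 0) ∧
      bar cs (toHecke P) = (LaurentPolynomial.T (-(cs.length w : ℤ)) : ℤ[T;T⁻¹]) • toHecke P := by
  constructor
  · intro h
    refine ⟨fun y hy => by_contra fun hn => hy (h.support y hn), h.diag, fun y hy k hk => ?_,
      h.bar_eq⟩
    by_cases hle : BruhatLE cs y w
    · have := h.degree y hle hy
      exact coeff_eq_zero_of_natDegree_lt (by lia)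
    · rw [h.support y hle, coeff_zero]
  · rintro ⟨h1, h2, h3, h4⟩
    refine ⟨fun y hy => by_contra fun hn => hy (h1 y hn), h2, fun y hle hy => ?_, h4⟩
    by_cases h0 : P y = 0
    · have := BruhatLE.length_lt cs hle hy
      rw [h0, natDegree_zero]; lia
    · by_contra hlt
      exact leadingCoeff_ne_zero.mpr h0 (h3 y hy _ (by lia))

/-- A polynomial of degree less than `N / 2` that equals `q^N` times its image under `q ↦ q⁻¹`
vanishes. -/
lemma eq_zero_of_invert_eq {p : ℤ[X]} {N : ℕ} (hp : ∀ k, N ≤ 2 * k → p.coeff k = 0)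
    (h : LaurentPolynomial.invert (toLaurent p) * LaurentPolynomial.T N = toLaurent p) : p = 0 := by
  by_contra h0
  have hd : 2 * p.natDegree < N := by
    by_contra hn
    exact leadingCoeff_ne_zero.mpr h0 (hp _ (by lia))
  have h1 : toLaurent (p.reverse * Polynomial.X ^ (N - p.natDegree)) = toLaurent p := by
    rw [map_mul, LaurentPolynomial.toLaurent_reverse, toLaurent_X_pow, mul_assoc,
      ← LaurentPolynomial.T_add, ← h]
    congr 2
    lia
  have h2 := toLaurent_injective h1
  apply leadingCoeff_ne_zero.mpr h0
  rw [leadingCoeff]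
  nth_rw 1 [← h2]
  rw [coeff_mul_X_pow', if_neg (by lia)]

/-- The difference of two Kazhdan-Lusztig families for `w` vanishes by descending induction on the
length: a term of maximal length is fixed by `q ↦ q⁻¹` up to a power of `q`, which the degree
condition permits only for `0`. -/
lemma IsKLFamily.unique {w : W} {P Q : W →₀ ℤ[X]} (hP : IsKLFamily cs w P)
    (hQ : IsKLFamily cs w Q) : P = Q := by
  classical
  obtain ⟨p1, p2, p3, p4⟩ := (isKLFamily_iff cs).mp hP
  obtain ⟨q1, q2, q3, q4⟩ := (isKLFamily_iff cs).mp hQ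
  have hz : ∀ y, cs.length w < cs.length y → (P - Q) y = 0 := by
    intro y hy
    have hn : ¬ BruhatLE cs y w := fun h => absurd (BruhatLE.length_le cs h) (by lia)
    rw [Finsupp.sub_apply, hP.support y hn, hQ.support y hn, sub_zero]
  -- descending induction on the length of `y`
  have key : ∀ n y, cs.length w + 1 ≤ cs.length y + n → (P - Q) y = 0 := by
    intro n
    induction n with
    | zero => exact fun y hy => hz y (by lia)
    | succ n ih =>
      intro y hy
      rcases lt_or_ge (cs.length w) (cs.length y) with hlt | hge
      · exact hz y hlt
      by_cases hyw : y = w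
      · rw [hyw, Finsupp.sub_apply, p2, q2, sub_self]
      have hbar : bar cs (toHecke (P - Q)) =
          (LaurentPolynomial.T (-(cs.length w : ℤ)) : ℤ[T;T⁻¹]) • toHecke (P - Q) := by
        have hs : toHecke P = toHecke (P - Q) + toHecke Q := by rw [toHecke_sub, sub_add_cancel]
        rw [hs, bar_add, q4, smul_add] at p4
        exact add_right_cancel p4
      have hy1 := congrArg (fun h : Hecke W => h y) hbar
      simp only [bar, Finsupp.smul_apply, Finsupp.mapRange_apply, smul_eq_mul] at hy1
      rw [Finsupp.sum, Finsupp.finsetSum_apply, Finset.sum_eq_single y] at hy1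
      · rw [Finsupp.smul_apply, barBasis_apply cs le_rfl, if_pos rfl, Finsupp.mapRange_apply,
          smul_eq_mul] at hy1
        refine eq_zero_of_invert_eq (N := cs.length w - cs.length y) (fun k hk => ?_) ?_
        · rw [Finsupp.sub_apply, coeff_sub, p3 y hyw k (by lia), q3 y hyw k (by lia), sub_self]
        · have h1 := congrArg (LaurentPolynomial.T (cs.length w : ℤ) * ·) hy1
          simp only [← mul_assoc, ← LaurentPolynomial.T_add] at h1
          rw [add_neg_cancel, LaurentPolynomial.T_zero, one_mul, LaurentPolynomial.T_mul, mul_assoc,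
            ← LaurentPolynomial.T_add] at h1
          rwa [Nat.cast_sub hge, sub_eq_add_neg]
      · intro z hz hne
        rw [Finsupp.smul_apply]
        by_cases hlz : cs.length z ≤ cs.length y
        · rw [barBasis_apply cs hlz, if_neg hne.symm, smul_zero]
        · have h0 := ih z (by lia)
          rw [Finsupp.mapRange_apply, h0]; simp
      · intro hn
        rw [Finsupp.notMem_support_iff.mp hn]; simp
  ext1 y
  exact sub_eq_zero.mp (key (cs.length w + 1) y (by lia))

lemma isKLFamily_one : IsKLFamily cs 1 (Finsupp.single 1 1) := by
  classical
  refine (isKLFamily_iff cs).mpr ⟨fun y hy => ?_, by simp, fun y hy k _ => ?_, ?_⟩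
  · have : y = 1 := by
      by_contra hn
      exact hy (Finsupp.single_eq_of_ne hn)
    rw [this]; exact Relation.ReflTransGen.refl
  · rw [Finsupp.single_eq_of_ne hy, coeff_zero]
  · simp [toHecke, bar_single, barBasis_one]

/-- `T_s + 1`, acting on families of polynomials. -/
noncomputable def addOneMul (i : B) (P : W →₀ ℤ[X]) : W →₀ ℤ[X] := leftMul cs Polynomial.X i P + P

open Classical in
lemma addOneMul_apply (i : B) (P : W →₀ ℤ[X]) (x : W) :
    addOneMul cs i P x = if cs.IsLeftDescent x i then Polynomial.X * P x + P (cs.simple i * x)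
      else P x + Polynomial.X * P (cs.simple i * x) := by
  rw [addOneMul, Finsupp.add_apply, leftMul_apply]
  split_ifs <;> ring

lemma toHecke_addOneMul (i : B) (P : W →₀ ℤ[X]) :
    toHecke (addOneMul cs i P) = heckeGen cs i (toHecke P) + toHecke P := by
  have h := leftMul_mapRange cs (Polynomial.X : ℤ[X]) (toLaurent : ℤ[X] →+* ℤ[T;T⁻¹]) i P
  rw [toLaurent_X] at h
  have e : heckeGen cs i (toHecke P) = toHecke (leftMul cs Polynomial.X i P) := h
  rw [e]
  ext x : 1
  simp [addOneMul]

lemma bar_addOneMul (i : B) (P : W →₀ ℤ[X]) :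
    bar cs (toHecke (addOneMul cs i P)) = (LaurentPolynomial.T (-1) : ℤ[T;T⁻¹]) •
      (heckeGen cs i (bar cs (toHecke P)) + bar cs (toHecke P)) := by
  rw [toHecke_addOneMul, bar_add, bar_heckeGen, heckeGenInv]
  simp only [LinearMap.add_apply, LinearMap.smul_apply, Module.End.one_apply, sub_smul, one_smul,
    smul_add]
  abel

open Classical in
/-- The indices of the correction terms in the recursion for Kazhdan-Lusztig polynomials. -/
noncomputable def corrSet (i : B) (w : W) (P : W →₀ ℤ[X]) : Finset W :=
  P.support.filter fun z => z ≠ w ∧ cs.IsLeftDescent z i ∧ Odd (cs.length w - cs.length z)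

/-- The leading coefficient `μ(z, w)`, from a family of polynomials. -/
noncomputable def muCoeff (w z : W) (P : W →₀ ℤ[X]) : ℤ :=
  (P z).coeff ((cs.length w - cs.length z - 1) / 2)

/-- The inductive step in the construction of the Kazhdan-Lusztig basis: if `s w > w`, then
`C'_s C'_w` is the sum of `C'_{sw}` and of the `μ(z, w) C'_z` with `z < w` and `s z < z`. -/
lemma isKLFamily_step {i : B} {w : W} (hw : ¬ cs.IsLeftDescent w i) {P : W →₀ ℤ[X]}
    (hP : IsKLFamily cs w P) {F : W → W →₀ ℤ[X]}
    (hF : ∀ z ∈ corrSet cs i w P, IsKLFamily cs z (F z)) :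
    IsKLFamily cs (cs.simple i * w) (addOneMul cs i P - ∑ z ∈ corrSet cs i w P,
      (C (muCoeff cs w z P) * Polynomial.X ^ ((cs.length w - cs.length z + 1) / 2)) • F z) := by
  classical
  obtain ⟨p1, p2, p3, p4⟩ := (isKLFamily_iff cs).mp hP
  have hl := cs.not_isLeftDescent_iff.mp hw
  have hww : BruhatLE cs w (cs.simple i * w) := bruhatLE_simple_mul cs hw
  have hc : ∀ z ∈ corrSet cs i w P, BruhatLE cs z w ∧ z ≠ w ∧ cs.IsLeftDescent z i ∧
      ∃ m, cs.length w - cs.length z = 2 * m + 1 := by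
    intro z hz
    obtain ⟨h1, h2, h3, h4⟩ := Finset.mem_filter.mp hz
    exact ⟨p1 z (Finsupp.mem_support_iff.mp h1), h2, h3, h4⟩
  refine (isKLFamily_iff cs).mpr ⟨?_, ?_, ?_, ?_⟩
  · intro y hy
    rw [Finsupp.sub_apply] at hy
    by_cases h0 : addOneMul cs i P y = 0
    · rw [h0, zero_sub, neg_ne_zero, Finsupp.finsetSum_apply] at hy
      obtain ⟨z, hz, hne⟩ := Finset.exists_ne_zero_of_sum_ne_zero hy
      rw [Finsupp.smul_apply] at hne
      have h1 := ((isKLFamily_iff cs).mp (hF z hz)).1 y (right_ne_zero_of_smul hne)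
      exact (h1.trans cs (hc z hz).1).trans cs hww
    · by_cases h1 : P y = 0
      · by_cases h2 : P (cs.simple i * y) = 0
        · rw [addOneMul_apply, h1, h2] at h0
          simp at h0
        · exact bruhatLE_of_simple_mul cs hw (p1 _ h2)
      · exact (p1 y h1).trans cs hww
  · have hn : ¬ BruhatLE cs (cs.simple i * w) w := fun h =>
      absurd (BruhatLE.length_le cs h) (by lia)
    have hd : cs.IsLeftDescent (cs.simple i * w) i := by
      rwa [cs.isLeftDescent_iff_not_isLeftDescent_mul, cs.simple_mul_simple_cancel_left]
    rw [Finsupp.sub_apply, addOneMul_apply, if_pos hd, cs.simple_mul_simple_cancel_left, p2,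
      hP.support _ hn, Finsupp.finsetSum_apply, Finset.sum_eq_zero, mul_zero, zero_add, sub_zero]
    intro z hz
    rw [Finsupp.smul_apply, (hF z hz).support _ fun h => hn (h.trans cs (hc z hz).1), smul_zero]
  · intro y hy k hk
    rw [hl] at hk
    rw [Finsupp.sub_apply, coeff_sub, sub_eq_zero, Finsupp.finsetSum_apply, finsetSum_coeff]
    have hterm : ∀ z ∈ corrSet cs i w P, z ≠ y →
        (((C (muCoeff cs w z P) *
          Polynomial.X ^ ((cs.length w - cs.length z + 1) / 2)) • F z) y).coeff k = 0 := by
      intro z hz hzy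
      obtain ⟨h1, h2, h3, m, hm⟩ := hc z hz
      rw [Finsupp.smul_apply, smul_eq_mul, mul_assoc, coeff_C_mul, coeff_X_pow_mul']
      split_ifs with h4
      · rw [((isKLFamily_iff cs).mp (hF z hz)).2.2.1 y hzy.symm, mul_zero]
        have := BruhatLE.length_lt cs h1 h2
        lia
      · rw [mul_zero]
    have hw0 : P (cs.simple i * w) = 0 :=
      hP.support _ fun h => absurd (BruhatLE.length_le cs h) (by lia)
    by_cases hyd : cs.IsLeftDescent y i
    · have hyl := cs.isLeftDescent_iff.mp hyd
      have hsy : cs.simple i * y ≠ w := by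
        rintro rfl
        exact hy (by rw [cs.simple_mul_simple_cancel_left])
      have hyw : y ≠ w := by rintro rfl; exact hw hyd
      rw [addOneMul_apply, if_pos hyd, coeff_add, p3 _ hsy k (by lia), add_zero]
      by_cases hyc : y ∈ corrSet cs i w P
      · obtain ⟨h1, h2, h3, m, hm⟩ := hc y hyc
        have hlt := BruhatLE.length_lt cs h1 h2
        rw [Finset.sum_eq_single y (fun z hz hzy => hterm z hz hzy) (fun h => absurd hyc h)]
        rw [Finsupp.smul_apply, (hF y hyc).diag, smul_eq_mul, mul_one, coeff_C_mul, coeff_X_pow,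
          muCoeff]
        rcases Nat.eq_zero_or_pos k with rfl | hk0
        · lia
        obtain ⟨k, rfl⟩ := Nat.exists_eq_add_of_lt hk0
        rw [zero_add, coeff_X_mul]
        split_ifs with h4
        · rw [mul_one]; congr 1; lia
        · rw [mul_zero, p3 y hyw k (by lia)]
      · rw [Finset.sum_eq_zero fun z hz => hterm z hz fun h => hyc (h ▸ hz)]
        rcases Nat.eq_zero_or_pos k with rfl | hk0
        · simp
        obtain ⟨k, rfl⟩ := Nat.exists_eq_add_of_lt hk0
        rw [zero_add, coeff_X_mul]
        by_contra hne
        have hP0 : P y ≠ 0 := fun h => hne (by rw [h, coeff_zero])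
        have hlt := BruhatLE.length_lt cs (p1 y hP0) hyw
        have h2k : ¬ cs.length w ≤ 2 * k + cs.length y := fun h => hne (p3 y hyw k h)
        exact hyc (Finset.mem_filter.mpr ⟨Finsupp.mem_support_iff.mpr hP0, hyw, hyd, k, by lia⟩)
    · have hyl := cs.not_isLeftDescent_iff.mp hyd
      have hyc : y ∉ corrSet cs i w P := fun h => hyd (hc y h).2.2.1
      rw [Finset.sum_eq_zero fun z hz => hterm z hz fun h => hyc (h ▸ hz), addOneMul_apply,
        if_neg hyd, coeff_add]
      have hsy : cs.simple i * y ≠ w := by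
        rintro rfl
        exact hw (by rwa [cs.isLeftDescent_iff_not_isLeftDescent_mul,
          cs.simple_mul_simple_cancel_left])
      have e1 : (P y).coeff k = 0 := by
        by_cases hyw : y = w
        · subst hyw
          rw [p2, coeff_one, if_neg (by lia)]
        · exact p3 y hyw k (by lia)
      rw [e1, zero_add]
      rcases Nat.eq_zero_or_pos k with rfl | hk0
      · simp
      obtain ⟨k, rfl⟩ := Nat.exists_eq_add_of_lt hk0
      rw [zero_add, coeff_X_mul]
      exact p3 _ hsy k (by lia)
  · rw [toHecke_sub, toHecke_sum, bar_sub, bar_sum, bar_addOneMul, p4, hl, smul_sub,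
      Finset.smul_sum]
    have h1 : (LaurentPolynomial.T (-((cs.length w + 1 : ℕ) : ℤ)) : ℤ[T;T⁻¹]) =
        LaurentPolynomial.T (-1) * LaurentPolynomial.T (-(cs.length w : ℤ)) := by
      rw [← LaurentPolynomial.T_add]; push_cast; ring_nf
    congr 1
    · simp only [toHecke_addOneMul, h1, map_smul, mul_smul, smul_add]
    · refine Finset.sum_congr rfl fun z hz => ?_
      obtain ⟨g1, g2, g3, m, hm⟩ := hc z hz
      have hlt := BruhatLE.length_lt cs g1 g2
      rw [toHecke_smul, bar_smul, ((isKLFamily_iff cs).mp (hF z hz)).2.2.2, smul_smul, smul_smul,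
        toLaurent_C_mul_X_pow, map_mul, LaurentPolynomial.invert_C, LaurentPolynomial.invert_T,
        mul_assoc, ← LaurentPolynomial.T_add, mul_left_comm, ← LaurentPolynomial.T_add]
      congr 3
      push_cast
      lia

theorem exists_isKLFamily (w : W) : ∃ P, IsKLFamily cs w P := by
  classical
  suffices h : ∀ n, ∀ w, cs.length w ≤ n → ∃ P, IsKLFamily cs w P from h _ w le_rfl
  intro n
  induction n with
  | zero =>
    intro w hw
    rw [cs.length_eq_zero_iff.mp (Nat.le_zero.mp hw)]
    exact ⟨_, isKLFamily_one cs⟩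
  | succ n ih =>
    intro w hw
    by_cases h1 : w = 1
    · rw [h1]
      exact ⟨_, isKLFamily_one cs⟩
    obtain ⟨i, hi⟩ := cs.exists_leftDescent_of_ne_one h1
    have hi1 := cs.isLeftDescent_iff.mp hi
    have hi2 := cs.isLeftDescent_iff_not_isLeftDescent_mul.mp hi
    obtain ⟨P, hP⟩ := ih (cs.simple i * w) (by lia)
    choose! F hF using ih
    have := isKLFamily_step cs hi2 hP (F := F) fun z hz => hF z ?_
    · rw [cs.simple_mul_simple_cancel_left] at this
      exact ⟨_, this⟩
    · have hz := Finsupp.mem_support_iff.mp (Finset.mem_filter.mp hz).1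
      have := BruhatLE.length_le cs (((isKLFamily_iff cs).mp hP).1 z hz)
      lia

/-- The family `y ↦ P_{y,w}`. -/
noncomputable def klFamily (w : W) : W →₀ ℤ[X] := Classical.epsilon (IsKLFamily cs w)

lemma isKLFamily_klFamily (w : W) : IsKLFamily cs w (klFamily cs w) :=
  Classical.epsilon_spec (exists_isKLFamily cs w)

lemma klPoly_eq (y w : W) : klPoly cs y w = klFamily cs w y := rfl

/-- The recursion for Kazhdan-Lusztig polynomials. -/
theorem klFamily_simple_mul {i : B} {w : W} (hw : ¬ cs.IsLeftDescent w i) :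
    klFamily cs (cs.simple i * w) = addOneMul cs i (klFamily cs w) -
      ∑ z ∈ corrSet cs i w (klFamily cs w),
        (C (muCoeff cs w z (klFamily cs w)) *
          Polynomial.X ^ ((cs.length w - cs.length z + 1) / 2)) • klFamily cs z :=
  (isKLFamily_klFamily cs _).unique cs
    (isKLFamily_step cs hw (isKLFamily_klFamily cs w) fun z _ => isKLFamily_klFamily cs z)

end KL

/-! ### The multiplication table of the Coxeter group of type `D_4` -/

instance : DecidableEq Leg := fun a b => by
  cases a <;> cases b <;> first | exact isTrue rfl | exact isFalse (by rintro ⟨⟩)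

instance : Fintype Leg := ⟨{.l1, .l2, .l4}, by rintro (_ | _ | _) <;> decide⟩

/-- The nodes of the Dynkin diagram `D_4`: the three legs and the central node `none`. -/
abbrev Node : Type := Option Leg

/-- The order of `s t` in the Coxeter group of type `D_4`. -/
def nodeOrder (s t : Node) : ℕ := if s = t then 1 else if s = none ∨ t = none then 3 else 2

/-- The Coxeter matrix of type `D_4`. -/
def nodeMatrix : CoxeterMatrix Node where
  M := nodeOrder
  isSymm := Matrix.IsSymm.ext (by decide)
  diagonal := by decide
  off_diagonal := by decide

/-- The diagram `D_4` as a subdiagram of itself. -/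
def stdSub : D4Sub nodeMatrix where
  leg := some
  center := none
  leg_center := by decide
  leg_leg := by decide

/-- The packing of a list of digits in base `b` into a number. -/
def pack (b : ℕ) : List ℕ → ℕ
  | [] => 0
  | a :: l => Nat.add a (Nat.mul b (pack b l))

/-- The `i`-th digit of `n` in base `2 ^ e`. Like the other functions that are evaluated on the
packed tables below, it is written with the operations on `ℕ` that have a fast kernel
implementation. -/
def digit (e i n : ℕ) : ℕ := Nat.mod (Nat.shiftRight n (Nat.mul e i)) (Nat.pow 2 e)

/-- The left multiplication table of the Coxeter group of type `D_4`. The 192 elements are numbered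
in an order compatible with the length, the identity being `0`; the table of `s` lists the numbers
of the elements `s x`. -/
def mulTable : Node → ℕ
  | some .l1 => pack 256
    [1, 0, 5, 10, 7, 2, 16, 4, 20, 15, 3, 24, 25, 28, 30, 9, 6, 34, 35, 38, 8, 40, 41, 44, 11, 12,
    47, 50, 13, 52, 14, 53, 54, 57, 17, 18, 60, 63, 19, 65, 21, 22, 67, 70, 23, 72, 66, 26, 75,
    77, 27, 79, 29, 31, 32, 82, 85, 33, 87, 81, 36, 90, 92, 37, 94, 39, 46, 42, 98, 100, 43, 102,
    45, 96, 105, 48, 107, 49, 108, 51, 103, 59, 55, 113, 115, 56, 117, 58, 111, 120, 61, 122, 62,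
    123, 64, 118, 73, 127, 68, 129, 69, 130, 71, 80, 133, 74, 135, 76, 78, 137, 132, 88, 140, 83,
    142, 84, 143, 86, 95, 146, 89, 148, 91, 93, 150, 145, 152, 97, 154, 99, 101, 156, 110, 104,
    158, 106, 159, 109, 161, 162, 112, 164, 114, 116, 166, 125, 119, 168, 121, 169, 124, 171, 126,
    172, 128, 173, 131, 175, 134, 136, 177, 138, 139, 178, 141, 179, 144, 181, 147, 149, 183, 151,
    153, 155, 185, 157, 182, 160, 163, 165, 188, 167, 176, 170, 187, 174, 189, 184, 180, 186, 191,
    190]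
  | some .l2 => pack 256
    [2, 5, 0, 11, 9, 1, 17, 15, 21, 4, 24, 3, 26, 29, 31, 7, 34, 6, 36, 39, 40, 8, 42, 45, 10, 47,
    12, 51, 52, 13, 53, 14, 55, 58, 16, 60, 18, 64, 65, 19, 20, 67, 22, 71, 72, 23, 59, 25, 76,
    78, 79, 27, 28, 30, 82, 32, 86, 87, 33, 46, 35, 91, 93, 94, 37, 38, 81, 41, 99, 101, 102, 43,
    44, 88, 106, 107, 48, 108, 49, 50, 95, 66, 54, 114, 116, 117, 56, 57, 73, 121, 122, 61, 123,
    62, 63, 80, 111, 128, 129, 68, 130, 69, 70, 118, 134, 135, 74, 75, 77, 136, 125, 96, 141, 142,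
    83, 143, 84, 85, 103, 147, 148, 89, 90, 92, 149, 110, 153, 154, 97, 98, 100, 155, 145, 158,
    104, 105, 109, 159, 160, 163, 164, 112, 113, 115, 165, 132, 168, 119, 120, 124, 169, 170, 172,
    126, 127, 131, 173, 174, 133, 137, 138, 177, 178, 139, 140, 144, 179, 180, 146, 150, 151, 183,
    152, 156, 157, 185, 184, 161, 162, 166, 167, 188, 187, 171, 176, 175, 190, 182, 181, 191, 186,
    189]
  | none => pack 256
    [3, 6, 8, 0, 13, 14, 1, 19, 2, 23, 16, 21, 27, 4, 5, 33, 10, 31, 37, 7, 30, 11, 43, 9, 46, 48,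
    49, 12, 38, 45, 20, 17, 56, 15, 59, 61, 62, 18, 28, 58, 66, 68, 69, 22, 57, 29, 24, 74, 25,
    26, 75, 78, 80, 81, 83, 84, 32, 44, 39, 34, 89, 35, 36, 90, 93, 95, 40, 97, 41, 42, 98, 101,
    103, 104, 47, 50, 106, 105, 51, 109, 52, 53, 112, 54, 55, 113, 116, 118, 119, 60, 63, 121,
    120, 64, 124, 65, 126, 67, 70, 128, 127, 71, 131, 72, 73, 77, 76, 136, 137, 79, 138, 139, 82,
    85, 141, 140, 86, 144, 87, 88, 92, 91, 149, 150, 94, 151, 96, 100, 99, 155, 156, 102, 157,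
    152, 147, 159, 107, 108, 110, 111, 115, 114, 165, 166, 117, 167, 162, 134, 169, 122, 123, 125,
    133, 163, 173, 129, 130, 132, 176, 135, 170, 175, 146, 153, 179, 142, 143, 145, 182, 148, 160,
    181, 184, 154, 180, 161, 158, 186, 187, 164, 174, 171, 168, 189, 172, 190, 177, 178, 191, 183,
    185, 188]
  | some .l4 => pack 256
    [4, 7, 9, 12, 0, 15, 18, 1, 22, 2, 25, 26, 3, 27, 32, 5, 35, 36, 6, 37, 41, 42, 8, 43, 47, 10,
    11, 13, 50, 51, 54, 55, 14, 56, 60, 16, 17, 19, 63, 64, 67, 20, 21, 23, 70, 71, 73, 24, 61,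
    69, 28, 29, 79, 82, 30, 31, 33, 85, 86, 88, 34, 48, 84, 38, 39, 94, 96, 40, 83, 49, 44, 45,
    102, 46, 104, 90, 91, 100, 101, 52, 110, 111, 53, 68, 62, 57, 58, 117, 59, 119, 75, 76, 115,
    116, 65, 125, 66, 126, 113, 114, 77, 78, 72, 132, 74, 133, 134, 122, 130, 138, 80, 81, 139,
    98, 99, 92, 93, 87, 145, 89, 146, 147, 107, 143, 151, 95, 97, 152, 153, 142, 108, 157, 103,
    105, 106, 158, 160, 161, 109, 112, 162, 163, 129, 123, 167, 118, 120, 121, 168, 170, 171, 124,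
    127, 128, 172, 174, 175, 131, 135, 177, 136, 137, 140, 141, 178, 180, 181, 144, 148, 183, 149,
    150, 154, 185, 155, 156, 186, 159, 164, 188, 165, 166, 189, 169, 190, 173, 176, 191, 179, 182,
    184, 187]

/-- The number of `s x`, where `x` is given by its number. -/
def lmul (s : Node) (x : ℕ) : ℕ := digit 8 x (mulTable s)

/-- The length of the element with number `x`. -/
def rank (x : ℕ) : ℕ := digit 4 x (pack 16
    [0, 1, 1, 1, 1, 2, 2, 2, 2, 2, 2, 2, 2, 2, 3, 3, 3, 3, 3, 3, 3, 3, 3, 3, 3, 3, 3, 3, 3, 3, 4, 4,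
    4, 4, 4, 4, 4, 4, 4, 4, 4, 4, 4, 4, 4, 4, 4, 4, 4, 4, 4, 4, 4, 5, 5, 5, 5, 5, 5, 5, 5, 5, 5,
    5, 5, 5, 5, 5, 5, 5, 5, 5, 5, 5, 5, 5, 5, 5, 5, 5, 5, 6, 6, 6, 6, 6, 6, 6, 6, 6, 6, 6, 6, 6,
    6, 6, 6, 6, 6, 6, 6, 6, 6, 6, 6, 6, 6, 6, 6, 6, 6, 7, 7, 7, 7, 7, 7, 7, 7, 7, 7, 7, 7, 7, 7,
    7, 7, 7, 7, 7, 7, 7, 7, 7, 7, 7, 7, 7, 7, 8, 8, 8, 8, 8, 8, 8, 8, 8, 8, 8, 8, 8, 8, 8, 8, 8,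
    8, 8, 8, 8, 8, 8, 9, 9, 9, 9, 9, 9, 9, 9, 9, 9, 9, 9, 9, 9, 9, 9, 10, 10, 10, 10, 10, 10, 10,
    10, 10, 11, 11, 11, 11, 12])

/-- A left descent of the element with number `x ≠ 0`. -/
def someDesc (x : ℕ) : Node :=
  bif Nat.blt (lmul (some .l1) x) x then some .l1
  else bif Nat.blt (lmul (some .l2) x) x then some .l2
  else bif Nat.blt (lmul none x) x then none
  else some .l4

set_option maxRecDepth 100000 in
lemma lmul_facts : ∀ x < 192, ∀ s : Node, lmul s x < 192 ∧ lmul s (lmul s x) = x ∧ lmul s x ≠ x ∧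
    (lmul s x < x → rank x = rank (lmul s x) + 1) := by decide +kernel

set_option maxRecDepth 100000 in
lemma someDesc_facts : ∀ x < 192, x ≠ 0 → lmul (someDesc x) x < x := by decide +kernel

set_option maxRecDepth 100000 in
/-- The dihedral cosets of two commuting simple reflections are squares, and multiplication by one
of them does not change whether the other is a descent. -/
lemma square_facts : ∀ x < 192, ∀ s t : Node, nodeOrder s t = 2 →
    lmul s (lmul t x) = lmul t (lmul s x) ∧ (lmul s (lmul t x) < lmul t x ↔ lmul s x < x) := by
  decide +kernel

set_option maxRecDepth 100000 in
lemma braid_facts : ∀ x < 192, ∀ s t : Node, nodeOrder s t = 3 →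
    lmul s (lmul t (lmul s x)) = lmul t (lmul s (lmul t x)) := by decide +kernel

set_option maxRecDepth 100000 in
/-- In a dihedral coset of order 6, the two paths down from the top element have length 3. -/
lemma hexagon_top : ∀ x < 192, ∀ s t : Node, nodeOrder s t = 3 → lmul s x < x → lmul t x < x →
    lmul s (lmul t x) < lmul t x ∧ lmul t (lmul s (lmul t x)) < lmul s (lmul t x) := by
  decide +kernel

set_option maxRecDepth 100000 in
/-- In a dihedral coset of order 6, an element at distance 2 from the bottom has a path
down to it. -/
lemma hexagon_side : ∀ x < 192, ∀ s t : Node, nodeOrder s t = 3 → lmul t x < x → x < lmul s x →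
    lmul s (lmul t x) < lmul t x → lmul s (lmul t x) < lmul t (lmul s (lmul t x)) := by
  decide +kernel

/-! ### Parabolic subgroups of type `D_4` -/

section Embed

variable {B W : Type*} [Group W] {M : CoxeterMatrix B} (cs : CoxeterSystem M W) (d : D4Sub M)

/-- The element of `S_0` at a node of the diagram. -/
def gen : Node → B
  | none => d.center
  | some i => d.leg i

lemma gen_mem (s : Node) : gen d s ∈ gens d := by
  rcases s with _ | i
  · exact Set.mem_insert _ _
  · exact Set.mem_insert_of_mem _ ⟨i, rfl⟩

lemma exists_gen_of_mem {b : B} (hb : b ∈ gens d) : ∃ s, b = gen d s := by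
  rcases hb with rfl | ⟨i, rfl⟩
  · exact ⟨none, rfl⟩
  · exact ⟨some i, rfl⟩

lemma order_gen (s t : Node) : M (gen d s) (gen d t) = nodeOrder s t := by
  rcases s with _ | i <;> rcases t with _ | j
  · exact M.diagonal _
  · rw [M.symmetric]; exact d.leg_center j
  · exact d.leg_center i
  · by_cases h : i = j
    · subst h; simp [nodeOrder]
    · have h1 := d.leg_leg i j h
      simpa [nodeOrder, h, gen] using h1

lemma nodeOrder_comm (s t : Node) : nodeOrder s t = nodeOrder t s := by
  revert s t; decide

lemma nodeOrder_cases {s t : Node} (h : s ≠ t) : nodeOrder s t = 2 ∨ nodeOrder s t = 3 := by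
  revert s t; decide

lemma gen_injective : Function.Injective (gen d) := by
  intro s t h
  by_contra hne
  have h1 := order_gen d s t
  rw [h, M.diagonal] at h1
  rcases nodeOrder_cases hne with h2 | h2 <;> lia

/-- The simple reflection of `W` at a node of the diagram. -/
noncomputable abbrev refl (s : Node) : W := cs.simple (gen d s)

lemma refl_comm {s t : Node} (h : nodeOrder s t = 2) :
    refl cs d s * refl cs d t = refl cs d t * refl cs d s := by
  have h1 := cs.simple_mul_simple_pow (gen d s) (gen d t)
  rw [order_gen, h, pow_two, mul_eq_one_iff_eq_inv] at h1
  simpa using h1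

lemma refl_braid {s t : Node} (h : nodeOrder s t = 3) :
    refl cs d s * (refl cs d t * refl cs d s) = refl cs d t * (refl cs d s * refl cs d t) := by
  have h1 := cs.simple_mul_simple_pow (gen d s) (gen d t)
  rw [order_gen, h, pow_succ, pow_two, mul_assoc, mul_eq_one_iff_eq_inv] at h1
  have h2 := congrArg (· * refl cs d s) h1
  simp only [mul_inv_rev, cs.inv_simple] at h2
  simpa [mul_assoc, refl] using h2

/-- The element of `W` whose number in the multiplication table of type `D_4` is `x`. -/
noncomputable def embed (x : ℕ) : W :=
  if _h : lmul (someDesc x) x < x then refl cs d (someDesc x) * embed (lmul (someDesc x) x) else 1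
termination_by x

lemma embed_zero : embed cs d 0 = 1 := by
  rw [embed, dif_neg (Nat.not_lt_zero _)]

lemma embed_someDesc {x : ℕ} (h : x < 192) (h0 : x ≠ 0) :
    embed cs d x = refl cs d (someDesc x) * embed cs d (lmul (someDesc x) x) := by
  rw [embed, dif_pos (someDesc_facts x h h0)]

/-- Any descent may be used in the definition of `embed`: two descents of `x` generate a dihedral
coset with top `x`, and the commutation or braid relation identifies its two paths. -/
lemma embed_of_desc {x : ℕ} (hx : x < 192) {s : Node} (hs : lmul s x < x) :
    embed cs d x = refl cs d s * embed cs d (lmul s x) := by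
  induction x using Nat.strong_induction_on generalizing s with
  | _ x ih =>
    have h0 : x ≠ 0 := by lia
    have ht := someDesc_facts x hx h0
    rw [embed_someDesc cs d hx h0]
    generalize someDesc x = t at ht
    by_cases hst : s = t
    · rw [hst]
    rcases nodeOrder_cases hst with h | h
    · have h' : nodeOrder t s = 2 := by rw [nodeOrder_comm, h]
      obtain ⟨e1, e2⟩ := square_facts x hx s t h
      obtain ⟨-, e3⟩ := square_facts x hx t s h'
      rw [ih _ ht (by lia) (e2.mpr hs), ih _ hs (by lia) (e3.mpr ht), e1, ← mul_assoc, ← mul_assoc,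
        refl_comm cs d h]
    · have h' : nodeOrder t s = 3 := by rw [nodeOrder_comm, h]
      obtain ⟨a1, a2⟩ := hexagon_top x hx s t h hs ht
      obtain ⟨b1, b2⟩ := hexagon_top x hx t s h' ht hs
      rw [ih _ ht (by lia) a1, ih _ (by lia) (by lia) a2, ih _ hs (by lia) b1,
        ih _ (by lia) (by lia) b2, braid_facts x hx s t h]
      simp only [← mul_assoc]
      congr 1
      simp only [mul_assoc]
      exact (refl_braid cs d h).symm

lemma embed_lmul {x : ℕ} (hx : x < 192) (s : Node) :
    embed cs d (lmul s x) = refl cs d s * embed cs d x := by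
  obtain ⟨h1, h2, h3, -⟩ := lmul_facts x hx s
  rcases lt_or_gt_of_ne h3 with h | h
  · rw [embed_of_desc cs d hx h, cs.simple_mul_simple_cancel_left]
  · rw [embed_of_desc cs d h1 (s := s) (by rwa [h2]), h2]

lemma embed_mem {x : ℕ} (hx : x < 192) : embed cs d x ∈ parabolic cs (gens d) := by
  induction x using Nat.strong_induction_on with
  | _ x ih =>
    by_cases h0 : x = 0
    · rw [h0, embed_zero]; exact Subgroup.one_mem _
    · rw [embed_someDesc cs d hx h0]
      have h1 := someDesc_facts x hx h0
      exact Subgroup.mul_mem _ (Subgroup.subset_closure ⟨_, gen_mem d _, rfl⟩)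
        (ih _ h1 (by lia))

lemma length_simple_mul_simple {i j : B} (h : i ≠ j) :
    cs.length (cs.simple i * cs.simple j) = 2 := by
  rcases cs.length_mul_simple (cs.simple i) j with h1 | h1
  · rw [h1, cs.length_simple]
  · rw [cs.length_simple] at h1
    have h2 : cs.simple i * cs.simple j = 1 := by rw [← cs.length_eq_zero_iff]; lia
    exact absurd (simple_injective cs (by rw [mul_eq_one_iff_eq_inv.mp h2, cs.inv_simple])) h

lemma length_simple_mul_simple_mul_simple {i j : B} (h : M i j = 3) :
    cs.length (cs.simple i * (cs.simple j * cs.simple i)) = 3 := by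
  have hij : i ≠ j := by
    rintro rfl
    rw [M.diagonal] at h
    lia
  have h2 := length_simple_mul_simple cs hij.symm
  rcases cs.length_simple_mul (cs.simple j * cs.simple i) i with h1 | h1
  · lia
  · exfalso
    -- a product `s_i s_j s_i` of length one is a simple reflection in the subgroup of `s_i`, `s_j`
    have hmem : cs.simple i * (cs.simple j * cs.simple i) ∈ parabolic cs {i, j} := by
      have hi : cs.simple i ∈ parabolic cs {i, j} := Subgroup.subset_closure ⟨i, by simp, rfl⟩
      have hj : cs.simple j ∈ parabolic cs {i, j} := Subgroup.subset_closure ⟨j, by simp, rfl⟩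
      exact Subgroup.mul_mem _ hi (Subgroup.mul_mem _ hj hi)
    obtain ⟨ω, hω, hr, he⟩ := exists_reduced_of_mem_parabolic cs hmem
    have hl := hr.eq
    rw [← he] at hl
    obtain ⟨k, rfl⟩ := List.length_eq_one_iff.mp (show ω.length = 1 by lia)
    rw [cs.wordProd_singleton] at he
    have hk := hω k (by simp)
    have h3 := cs.simple_mul_simple_pow i j
    rw [h, pow_succ, pow_two] at h3
    rcases hk with rfl | rfl
    · have h4 : cs.simple j * cs.simple k = 1 := mul_left_cancel (he.trans (mul_one _).symm)
      rw [h4, cs.length_one] at h2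
      lia
    · have h4 : cs.simple i * cs.simple k * (cs.simple i * cs.simple k) = 1 := by
        rw [mul_assoc, ← mul_assoc (cs.simple k), ← mul_assoc, ← mul_assoc,
          mul_assoc (cs.simple i), he, cs.simple_mul_simple_self]
      rw [h4, one_mul] at h3
      have h5 := length_simple_mul_simple cs hij
      rw [h3, cs.length_one] at h5
      lia

/-- An ascent in the multiplication table is an ascent in `W`. The element is reduced to a minimal
representative modulo the dihedral group of two descents, where lengths add. -/
lemma not_isLeftDescent_embed {x : ℕ} (hx : x < 192) {s : Node} (hs : x < lmul s x) :
    ¬ cs.IsLeftDescent (embed cs d x) (gen d s) := by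
  induction x using Nat.strong_induction_on generalizing s with
  | _ x ih =>
    by_cases h0 : x = 0
    · rw [h0, embed_zero]; exact cs.not_isLeftDescent_one _
    have ht := someDesc_facts x hx h0
    generalize someDesc x = t at ht
    have hst : s ≠ t := by rintro rfl; lia
    obtain ⟨l1, l2, l3, -⟩ := lmul_facts x hx t
    have hz : ∀ y < x, y < lmul s y → y < lmul t y →
        embed cs d y ∈ minReps cs {gen d s, gen d t} := by
      intro y hy h1 h2 i hi
      rcases hi with rfl | rfl
      · exact ih y hy (by lia) h1
      · exact ih y hy (by lia) h2
    have hps : refl cs d s ∈ parabolic cs {gen d s, gen d t} :=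
      Subgroup.subset_closure ⟨_, by simp, rfl⟩
    have hpt : refl cs d t ∈ parabolic cs {gen d s, gen d t} :=
      Subgroup.subset_closure ⟨_, by simp, rfl⟩
    -- the case where `t x` is the minimal representative
    have key : lmul t x < lmul s (lmul t x) →
        ¬ cs.IsLeftDescent (embed cs d x) (gen d s) := by
      intro h1
      have h2 := hz _ ht h1 (by rw [l2]; exact ht)
      rw [embed_of_desc cs d hx ht, isLeftDescent_mul_iff cs hpt h2 (by simp),
        CoxeterSystem.IsLeftDescent, length_simple_mul_simple cs fun h => hst (gen_injective d h),
        cs.length_simple]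
      lia
    rcases nodeOrder_cases hst with h | h
    · apply key
      obtain ⟨-, e⟩ := square_facts x hx s t h
      have := (lmul_facts _ l1 s).2.2.1
      lia
    · by_cases h1 : lmul s (lmul t x) < lmul t x
      · obtain ⟨m1, m2, m3, -⟩ := lmul_facts _ l1 s
        have h2 := hz _ (by lia) (by rwa [m2]) (hexagon_side x hx s t h ht hs h1)
        rw [embed_of_desc cs d hx ht, embed_of_desc cs d l1 h1, ← mul_assoc,
          isLeftDescent_mul_iff cs (Subgroup.mul_mem _ hpt hps) h2 (by simp),
          CoxeterSystem.IsLeftDescent, length_simple_mul_simple_mul_simple cs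
            (by rw [order_gen, h]),
          length_simple_mul_simple cs fun h => hst (gen_injective d h.symm)]
        lia
      · have := (lmul_facts _ l1 s).2.2.1
        exact key (by lia)

lemma isLeftDescent_embed_iff {x : ℕ} (hx : x < 192) (s : Node) :
    cs.IsLeftDescent (embed cs d x) (gen d s) ↔ lmul s x < x := by
  obtain ⟨h1, h2, h3, -⟩ := lmul_facts x hx s
  constructor
  · intro h
    by_contra hn
    exact not_isLeftDescent_embed cs d hx (by lia) h
  · intro h
    have := not_isLeftDescent_embed cs d h1 (s := s) (by rwa [h2])
    rwa [embed_lmul cs d hx, ← cs.isLeftDescent_iff_not_isLeftDescent_mul] at this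

lemma length_embed {x : ℕ} (hx : x < 192) : cs.length (embed cs d x) = rank x := by
  induction x using Nat.strong_induction_on with
  | _ x ih =>
    by_cases h0 : x = 0
    · rw [h0, embed_zero, cs.length_one]; decide +kernel
    have ht := someDesc_facts x hx h0
    obtain ⟨h1, h2, h3, h4⟩ := lmul_facts x hx (someDesc x)
    have h5 := cs.isLeftDescent_iff.mp ((isLeftDescent_embed_iff cs d hx _).mpr ht)
    rw [← embed_lmul cs d hx, ih _ ht h1] at h5
    rw [h4 ht, h5]

lemma embed_injOn {x y : ℕ} (hx : x < 192) (hy : y < 192) (h : embed cs d x = embed cs d y) :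
    x = y := by
  induction x using Nat.strong_induction_on generalizing y with
  | _ x ih =>
    by_cases h0 : x = 0
    · by_contra hne
      have ht := someDesc_facts y hy (by lia)
      rw [← isLeftDescent_embed_iff cs d hy, ← h, h0, embed_zero] at ht
      exact cs.not_isLeftDescent_one _ ht
    · have ht := someDesc_facts x hx h0
      obtain ⟨a1, a2, -⟩ := lmul_facts x hx (someDesc x)
      obtain ⟨b1, b2, -⟩ := lmul_facts y hy (someDesc x)
      have := ih _ ht a1 b1 (by rw [embed_lmul cs d hx, embed_lmul cs d hy, h])
      rw [← a2, this, b2]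

/-- The number of the product of a word. -/
def wordIdx : List Node → ℕ
  | [] => 0
  | s :: ω => lmul s (wordIdx ω)

lemma wordIdx_lt (ω : List Node) : wordIdx ω < 192 := by
  induction ω with
  | nil => decide
  | cons s ω ih => exact (lmul_facts _ ih s).1

lemma embed_wordIdx (ω : List Node) :
    embed cs d (wordIdx ω) = cs.wordProd (ω.map (gen d)) := by
  induction ω with
  | nil => rw [wordIdx, embed_zero]; simp
  | cons s ω ih => rw [wordIdx, embed_lmul cs d (wordIdx_lt ω), ih, List.map_cons, cs.wordProd_cons]

lemma exists_map_gen {ω : List B} (hω : ∀ i ∈ ω, i ∈ gens d) :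
    ∃ ω' : List Node, ω = ω'.map (gen d) := by
  induction ω with
  | nil => exact ⟨[], rfl⟩
  | cons b ω ih =>
    obtain ⟨ω', rfl⟩ := ih fun i hi => hω i (by simp [hi])
    obtain ⟨s, rfl⟩ := exists_gen_of_mem d (hω b (by simp))
    exact ⟨s :: ω', rfl⟩

lemma exists_embed_eq {u : W} (hu : u ∈ parabolic cs (gens d)) : ∃ x < 192, u = embed cs d x := by
  obtain ⟨ω, hω, -, rfl⟩ := exists_reduced_of_mem_parabolic cs hu
  obtain ⟨ω', rfl⟩ := exists_map_gen d hω
  exact ⟨wordIdx ω', wordIdx_lt ω', (embed_wordIdx cs d ω').symm⟩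

end Embed

/-! ### Restriction of the recursion to a coset of `W_{D_4}` -/

section Coset

open Polynomial

variable {B W : Type*} [Group W] {M : CoxeterMatrix B} (cs : CoxeterSystem M W) (d : D4Sub M)

/-- The Kazhdan-Lusztig polynomial `P_{xa,wa}`, for elements `x`, `w` of `W_{D_4}` given by their
numbers. -/
noncomputable def cosetKL (a : W) (w x : ℕ) : ℤ[X] :=
  klFamily cs (embed cs d w * a) (embed cs d x * a)

lemma length_embed_mul {a : W} (ha : a ∈ minReps cs (gens d)) {x : ℕ} (hx : x < 192) :
    cs.length (embed cs d x * a) = rank x + cs.length a := by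
  rw [length_mul_of_mem_minReps cs (embed_mem cs d hx) ha, length_embed cs d hx]

lemma isLeftDescent_embed_mul {a : W} (ha : a ∈ minReps cs (gens d))
    {x : ℕ} (hx : x < 192) (s : Node) :
    cs.IsLeftDescent (embed cs d x * a) (gen d s) ↔ lmul s x < x := by
  rw [isLeftDescent_mul_iff cs (embed_mem cs d hx) ha (gen_mem d s),
    isLeftDescent_embed_iff cs d hx]

lemma embed_mul_injOn (a : W) {x y : ℕ} (hx : x < 192) (hy : y < 192)
    (h : embed cs d x * a = embed cs d y * a) : x = y :=
  embed_injOn cs d hx hy (mul_right_cancel h)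

/-- A correction term that contributes to the coset `W_{D_4} a` comes from that coset: the minimal
length of the coset increases along the Bruhat order. -/
lemma exists_eq_embed_mul {a : W} (ha : a ∈ minReps cs (gens d))
    {w x : ℕ} (hw : w < 192) (hx : x < 192) {z : W}
    (h1 : BruhatLE cs z (embed cs d w * a)) (h2 : BruhatLE cs (embed cs d x * a) z) :
    ∃ v < 192, z = embed cs d v * a := by
  obtain ⟨v, hv, b, hb, rfl⟩ := exists_parabolic_mul_minReps cs (gens d) z
  obtain ⟨n, hn, rfl⟩ := exists_embed_eq cs d hv
  have e1 := minReps_of_bruhatLE cs h1 hv (embed_mem cs d hw) hb ha rfl rfl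
  have e2 := minReps_of_bruhatLE cs h2 (embed_mem cs d hx) hv ha hb rfl rfl
  refine ⟨n, hn, ?_⟩
  rcases e1 with rfl | e1
  · rfl
  rcases e2 with rfl | e2
  · rfl
  lia

lemma cosetKL_degree {a : W} (ha : a ∈ minReps cs (gens d))
    {w x k : ℕ} (hw : w < 192) (hx : x < 192) (hne : x ≠ w)
    (hk : rank w ≤ 2 * k + rank x) : (cosetKL cs d a w x).coeff k = 0 := by
  refine ((isKLFamily_iff cs).mp (isKLFamily_klFamily cs _)).2.2.1 _
    (fun h => hne (embed_mul_injOn cs d a hx hw h)) k ?_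
  rw [length_embed_mul cs d ha hw, length_embed_mul cs d ha hx]
  lia

lemma cosetKL_self (a : W) (w : ℕ) : cosetKL cs d a w w = 1 := (isKLFamily_klFamily cs _).diag

/-- The recursion for Kazhdan-Lusztig polynomials, restricted to a coset `W_{D_4} a`. -/
theorem cosetKL_lmul {a : W} (ha : a ∈ minReps cs (gens d))
    {s : Node} {w x : ℕ} (hw : w < 192) (hx : x < 192) (hs : w < lmul s w) :
    cosetKL cs d a (lmul s w) x +
      ∑ z ∈ Finset.range 192 with lmul s z < z ∧ Odd (rank w - rank z),
        (C ((cosetKL cs d a w z).coeff ((rank w - rank z - 1) / 2)) *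
          Polynomial.X ^ ((rank w - rank z + 1) / 2)) * cosetKL cs d a z x =
    if lmul s x < x then Polynomial.X * cosetKL cs d a w x + cosetKL cs d a w (lmul s x)
      else cosetKL cs d a w x + Polynomial.X * cosetKL cs d a w (lmul s x) := by
  classical
  have hnd : ¬ cs.IsLeftDescent (embed cs d w * a) (gen d s) := by
    rw [isLeftDescent_embed_mul cs d ha hw]; lia
  have h1 := congrArg (fun P : W →₀ ℤ[X] => P (embed cs d x * a)) (klFamily_simple_mul cs hnd)
  simp only [Finsupp.sub_apply, addOneMul_apply, isLeftDescent_embed_mul cs d ha hx, ← mul_assoc,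
    ← embed_lmul cs d hw, ← embed_lmul cs d hx] at h1
  rw [eq_sub_iff_add_eq] at h1
  refine Eq.trans ?_ h1
  congr 1
  rw [Finsupp.finsetSum_apply]
  have hP := isKLFamily_klFamily cs (embed cs d w * a)
  rw [← Finset.sum_filter_ne_zero]
  refine Finset.sum_of_injOn (fun z => embed cs d z * a) ?_ ?_ ?_ ?_
  · intro y hy z hz h
    simp only [Finset.coe_filter, Finset.mem_filter, Finset.mem_range, Set.mem_ofPred_eq] at hy hz
    exact embed_mul_injOn cs d a hy.1.1 hz.1.1 h
  · intro z hz
    simp only [Finset.coe_filter, Finset.mem_filter, Finset.mem_range, Set.mem_ofPred_eq] at hz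
    obtain ⟨⟨hz, hd, ho⟩, hne⟩ := hz
    have h0 : cosetKL cs d a w z ≠ 0 := by
      intro h0
      rw [h0] at hne
      simp at hne
    simp only [corrSet, Finset.coe_filter, Finsupp.mem_support_iff, Set.mem_ofPred_eq]
    refine ⟨h0, fun h => ?_, (isLeftDescent_embed_mul cs d ha hz s).mpr hd, ?_⟩
    · rw [embed_mul_injOn cs d a hz hw h] at ho
      simp at ho
    · rw [length_embed_mul cs d ha hw, length_embed_mul cs d ha hz]
      rwa [Nat.add_sub_add_right]
  · intro z hz hn
    by_contra hne
    rw [Finsupp.smul_apply] at hne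
    obtain ⟨g1, g2, g3, g4⟩ := Finset.mem_filter.mp hz
    have k1 := ((isKLFamily_iff cs).mp hP).1 z (Finsupp.mem_support_iff.mp g1)
    have k2 := ((isKLFamily_iff cs).mp (isKLFamily_klFamily cs z)).1 _ (right_ne_zero_of_smul hne)
    obtain ⟨v, hv, rfl⟩ := exists_eq_embed_mul cs d ha hw hx k1 k2
    refine hn ⟨v, ?_, rfl⟩
    rw [length_embed_mul cs d ha hw, length_embed_mul cs d ha hv, Nat.add_sub_add_right] at g4
    rw [isLeftDescent_embed_mul cs d ha hv] at g3
    simp only [Finset.coe_filter, Finset.mem_filter, Finset.mem_range, Set.mem_ofPred_eq]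
    refine ⟨⟨hv, g3, g4⟩, fun h0 => hne ?_⟩
    rw [muCoeff, length_embed_mul cs d ha hw, length_embed_mul cs d ha hv, Nat.add_sub_add_right]
    exact h0
  · intro z hz
    simp only [Finset.mem_filter, Finset.mem_range] at hz
    rw [Finsupp.smul_apply, muCoeff, length_embed_mul cs d ha hw, length_embed_mul cs d ha hz.1.1,
      Nat.add_sub_add_right]
    rfl

end Coset

/-! ### Tables of Kazhdan-Lusztig polynomials of type `D_4` -/

/-- Iteration of `f m`, for `m < n` in increasing order. -/
def loop (f : ℕ → ℕ → ℕ) (a n : ℕ) : ℕ := Nat.rec a (fun m r => f m r) n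

/-- `f m` holds for all `m < n`. -/
def allBelow (f : ℕ → Bool) (n : ℕ) : Bool := Nat.rec true (fun m r => and (f m) r) n

lemma allBelow_iff {f : ℕ → Bool} {n : ℕ} : allBelow f n = true ↔ ∀ m < n, f m = true := by
  induction n with
  | zero => simp [allBelow]
  | succ n ih =>
    have h : allBelow f (n + 1) = (f n && allBelow f n) := rfl
    rw [h, Bool.and_eq_true, ih]
    refine ⟨fun ⟨h1, h2⟩ m hm => ?_, fun h => ⟨h n (by lia), fun m hm => h m (by lia)⟩⟩
    rcases Nat.lt_succ_iff_lt_or_eq.mp hm with h3 | rfl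
    exacts [h2 m h3, h1]

/-- The row of `w` in a packed table: the polynomials `P_{x,w}` for all `x`, with 12 bits each. -/
def row (T w : ℕ) : ℕ := digit 2304 w T

/-- The entry of `x` in a row: three coefficients with 4 bits each. -/
def ent (R x : ℕ) : ℕ := digit 12 x R

/-- The coefficient of `q ^ k` in an entry; the degrees are at most 2 and the coefficients less
than 16 in the range of the tables. -/
def cf (E k : ℕ) : ℕ := bif Nat.blt k 3 then digit 4 k E else 0

/-- The element `z` has the left descent `s`, and `l(w) - l(z)` is positive and odd. -/
def isCorr (s : Node) (w z : ℕ) : Bool :=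
  and (Nat.blt (lmul s z) z) (Nat.beq (Nat.mod (Nat.sub (rank w) (rank z)) 2) 1)

/-- `μ(z, w)`, from the row `R` of `w`. -/
def muEnt (R w z : ℕ) : ℕ :=
  cf (ent R z) (Nat.div (Nat.sub (Nat.sub (rank w) (rank z)) 1) 2)

/-- The exponent `(l(w) - l(z) + 1) / 2`. -/
def corrExp (w z : ℕ) : ℕ := Nat.div (Nat.add (Nat.sub (rank w) (rank z)) 1) 2

/-- The entry of `x` in `(T_s + 1) ∑ P_{x,w} T_x`, where `R` is the row of `w`. -/
def mulEnt (s : Node) (R x : ℕ) : ℕ :=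
  bif Nat.blt (lmul s x) x then Nat.add (Nat.mul 16 (ent R x)) (ent R (lmul s x))
  else Nat.add (ent R x) (Nat.mul 16 (ent R (lmul s x)))

/-- The row of `(T_s + 1) ∑ P_{x,w} T_x`. -/
def mulRow (s : Node) (R : ℕ) : ℕ :=
  loop (fun x acc => Nat.add acc (Nat.shiftLeft (mulEnt s R x) (Nat.mul 12 x))) 0 192

/-- The sum of the correction terms in the recursion for `P_{x,sw}`. -/
def corrRow (T : ℕ) (s : Node) (w R : ℕ) : ℕ :=
  loop (fun z acc => bif isCorr s w z then
    Nat.add acc (Nat.shiftLeft (Nat.mul (muEnt R w z) (row T z)) (Nat.mul 4 (corrExp w z)))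
    else acc) 0 w

/-- The row of `w`, from a table that contains the rows of all smaller numbers. -/
def nextRow (T w : ℕ) : ℕ :=
  (fun s => (fun v => (fun R => Nat.sub (mulRow s R) (corrRow T s v R)) (row T v)) (lmul s w))
    (someDesc w)

/-- The table of all `P_{x,w}` of type `D_4` with `l(w) ≤ 9`, which are the first 178 elements `w`.
Nothing is proved about this construction: that no carries or truncated differences occur is part of
the check that the resulting table satisfies the recursion. -/
def klTable : ℕ :=
  loop (fun m T => Nat.add T (Nat.shiftLeft (nextRow T (Nat.add m 1)) (Nat.mul 2304 (Nat.add m 1))))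
    1 177

/-- The correction terms with nonzero coefficient, as triples of the coefficient, the exponent and
the row. -/
def corrList (T : ℕ) (s : Node) (w R n : ℕ) : List (ℕ × ℕ × ℕ) :=
  Nat.rec [] (fun z l => bif isCorr s w z then
    (bif Nat.beq (muEnt R w z) 0 then l else (muEnt R w z, corrExp w z, row T z) :: l) else l) n

/-- The coefficient of `q ^ k` in the entry of `x` in the sum of a list of correction terms. -/
def corrSum (x k : ℕ) (l : List (ℕ × ℕ × ℕ)) : ℕ :=
  List.rec 0 (fun p _ r => Nat.add r
    (bif Nat.ble p.2.1 k then Nat.mul p.1 (cf (ent p.2.2 x) (Nat.sub k p.2.1)) else 0)) l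

/-- The sum of the entries of `x` in a list of correction terms; it vanishes if all of them do. -/
def entSum (x : ℕ) (l : List (ℕ × ℕ × ℕ)) : ℕ :=
  List.rec 0 (fun p _ r => Nat.add r (ent p.2.2 x)) l

/-- The coefficient of `q ^ k` in the left hand side of the recursion, from the entries `A` of `x`
and `E` of `s x`. -/
def mulCoef (s : Node) (x A E k : ℕ) : ℕ :=
  bif Nat.blt (lmul s x) x then Nat.add (bif Nat.beq k 0 then 0 else cf A (Nat.sub k 1)) (cf E k)
  else Nat.add (cf A k) (bif Nat.beq k 0 then 0 else cf E (Nat.sub k 1))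

/-- The recursion holds for the entry of `x`; this is plain if all entries involved vanish. -/
def checkEnt (s : Node) (x A E N : ℕ) (l : List (ℕ × ℕ × ℕ)) : Bool :=
  or (Nat.beq (Nat.add (Nat.add A E) (Nat.add N (entSum x l))) 0)
    (allBelow (fun k => Nat.beq (Nat.add (cf N k) (corrSum x k l)) (mulCoef s x A E k)) 5)

/-- The recursion holds for the row of `w`. -/
def checkRow (T w : ℕ) : Bool :=
  (fun s => (fun v => (fun R => (fun N => (fun l =>
    allBelow (fun x => checkEnt s x (ent R x) (ent R (lmul s x)) (ent N x) l) 192)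
      (corrList T s v R v)) (row T w)) (row T v)) (lmul s w)) (someDesc w)

/-- The coefficient of `q ^ k` in `P_{x,w}`, from a table. -/
def coef (T w x k : ℕ) : ℕ := cf (ent (row T w) x) k

/-- The table contains the row of the identity and satisfies the recursion in all rows below `n`. -/
def IsKLTable (T n : ℕ) : Prop := row T 0 = 1 ∧ ∀ w < n, 0 < w → checkRow T w = true

set_option exponentiation.threshold 2304 in
set_option maxRecDepth 100000 in
theorem isKLTable_klTable : IsKLTable klTable 178 := by
  have h : and (Nat.beq (row klTable 0) 1)
      (allBelow (fun w => checkRow klTable (Nat.add w 1)) 177) = true := by decide +kernel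
  rw [Bool.and_eq_true, allBelow_iff] at h
  refine ⟨Nat.eq_of_beq_eq_true h.1, fun w hw h0 => ?_⟩
  obtain ⟨v, rfl⟩ := Nat.exists_eq_add_of_lt h0
  rw [Nat.zero_add]
  exact h.2 v (by lia)

lemma cf_zero (k : ℕ) : cf 0 k = 0 := by
  unfold cf digit
  cases Nat.blt k 3 with
  | false => rfl
  | true =>
    change Nat.mod (0 >>> (4 * k)) (2 ^ 4) = 0
    rw [Nat.zero_shiftRight]; rfl

lemma cf_of_le {E k : ℕ} (h : 3 ≤ k) : cf E k = 0 := by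
  have : Nat.blt k 3 = false := by
    rw [Bool.eq_false_iff, Ne, Nat.blt_eq]; lia
  rw [cf, this]; rfl

lemma isCorr_iff {s : Node} {w z : ℕ} :
    isCorr s w z = true ↔ lmul s z < z ∧ Odd (rank w - rank z) := by
  rw [isCorr, Bool.and_eq_true, Nat.blt_eq, Nat.beq_eq, Nat.odd_iff]
  rfl

lemma corrSum_corrList (T : ℕ) (s : Node) (w R n x k : ℕ) :
    corrSum x k (corrList T s w R n) =
      ∑ z ∈ Finset.range n with lmul s z < z ∧ Odd (rank w - rank z), muEnt R w z *
        if corrExp w z ≤ k then coef T z x (k - corrExp w z) else 0 := by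
  induction n with
  | zero => rfl
  | succ n ih =>
    rw [Finset.range_add_one, Finset.filter_insert]
    have h : corrList T s w R (n + 1) = bif isCorr s w n then
        (bif Nat.beq (muEnt R w n) 0 then corrList T s w R n
          else (muEnt R w n, corrExp w n, row T n) :: corrList T s w R n)
        else corrList T s w R n := rfl
    rw [h]
    by_cases h1 : lmul s n < n ∧ Odd (rank w - rank n)
    · rw [if_pos h1, isCorr_iff.mpr h1, cond_true, Finset.sum_insert (by simp)]
      by_cases h2 : muEnt R w n = 0
      · rw [h2, Nat.zero_mul, zero_add, ← ih]; rfl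
      · have h3 : Nat.beq (muEnt R w n) 0 = false := by
          rw [Bool.eq_false_iff, Ne, Nat.beq_eq]; exact h2
        rw [h3, cond_false, add_comm, ← ih]
        change corrSum x k (corrList T s w R n) + (bif Nat.ble (corrExp w n) k then
          muEnt R w n * coef T n x (k - corrExp w n) else 0) = _
        by_cases h4 : corrExp w n ≤ k
        · rw [Nat.ble_eq_true_of_le h4, if_pos h4, cond_true]
        · have h5 : Nat.ble (corrExp w n) k = false := by
            rw [Bool.eq_false_iff, Ne, Nat.ble_eq]; exact h4
          rw [if_neg h4, h5, cond_false, Nat.mul_zero]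
    · rw [if_neg h1, (Bool.eq_false_iff.mpr fun h => h1 (isCorr_iff.mp h)), cond_false, ih]

lemma corrSum_eq_zero {x : ℕ} (k : ℕ) {l : List (ℕ × ℕ × ℕ)} (h : entSum x l = 0) :
    corrSum x k l = 0 := by
  induction l with
  | nil => rfl
  | cons p l ih =>
    have h1 : entSum x l + ent p.2.2 x = 0 := h
    change corrSum x k l +
      (bif Nat.ble p.2.1 k then p.1 * cf (ent p.2.2 x) (k - p.2.1) else 0) = 0
    rw [ih (by lia), show ent p.2.2 x = 0 by lia, cf_zero]
    cases Nat.ble p.2.1 k <;> rfl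

lemma mulCoef_eq (s : Node) (x A E k : ℕ) : mulCoef s x A E k =
    if lmul s x < x then (if k = 0 then 0 else cf A (k - 1)) + cf E k
      else cf A k + if k = 0 then 0 else cf E (k - 1) := by
  have h1 : Nat.blt (lmul s x) x = decide (lmul s x < x) := by
    rw [Bool.eq_iff_iff, Nat.blt_eq, decide_eq_true_iff]
  have h2 : Nat.beq k 0 = decide (k = 0) := by
    rw [Bool.eq_iff_iff, Nat.beq_eq, decide_eq_true_iff]
  rw [mulCoef, h1, h2]
  simp only [Bool.cond_decide]
  rfl

lemma checkEnt_spec {s : Node} {x A E N : ℕ} {l : List (ℕ × ℕ × ℕ)}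
    (h : checkEnt s x A E N l = true) {k : ℕ} (hk : k < 5) :
    cf N k + corrSum x k l = mulCoef s x A E k := by
  rw [checkEnt, Bool.or_eq_true, Nat.beq_eq, allBelow_iff] at h
  rcases h with h | h
  · have h1 : A + E + (N + entSum x l) = 0 := h
    rw [corrSum_eq_zero k (by lia), mulCoef_eq, show A = 0 by lia, show E = 0 by lia,
      show N = 0 by lia]
    simp [cf_zero]
  · exact Nat.eq_of_beq_eq_true (h k hk)

/-- The recursion, in terms of the coefficients in a table. -/
lemma IsKLTable.recursion {T n w x k : ℕ} (hT : IsKLTable T n) (hw : w < n) (h0 : 0 < w)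
    (hx : x < 192) (hk : k < 5) {s : Node} (hs : s = someDesc w) {v : ℕ} (hv : v = lmul s w) :
    coef T w x k + ∑ z ∈ Finset.range v with lmul s z < z ∧ Odd (rank v - rank z),
        coef T v z ((rank v - rank z - 1) / 2) * (if (rank v - rank z + 1) / 2 ≤ k then
          coef T z x (k - (rank v - rank z + 1) / 2) else 0) =
      if lmul s x < x then (if k = 0 then 0 else coef T v x (k - 1)) + coef T v (lmul s x) k
        else coef T v x k + if k = 0 then 0 else coef T v (lmul s x) (k - 1) := by
  have h := hT.2 w hw h0
  rw [checkRow] at h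
  simp only [← hs, ← hv] at h
  have h1 := checkEnt_spec (allBelow_iff.mp h x hx) hk
  rw [mulCoef_eq, corrSum_corrList] at h1
  exact h1

lemma IsKLTable.coef_zero {T n x k : ℕ} (hT : IsKLTable T n) (hx : x < 192) :
    coef T 0 x k = if x = 0 ∧ k = 0 then 1 else 0 := by
  rcases lt_or_ge k 3 with h | h
  · have h1 : ∀ x < 192, ∀ k < 3, cf (ent 1 x) k = if x = 0 ∧ k = 0 then 1 else 0 := by
      decide +kernel
    rw [coef, hT.1, h1 x hx k h]
  · rw [coef, cf_of_le h, if_neg (by lia)]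

set_option maxRecDepth 100000 in
lemma rank_mono : ∀ x < 192, ∀ y < x, rank y ≤ rank x := by decide +kernel

set_option maxRecDepth 100000 in
lemma rank_le_nine : ∀ x < 178, rank x ≤ 9 := by decide +kernel

section Agreement

open Polynomial

variable {B W : Type*} [Group W] {M : CoxeterMatrix B} (cs : CoxeterSystem M W) (d : D4Sub M)

/-- A table that satisfies the recursion of type `D_4` contains the polynomials `P_{xa,wa}`. -/
theorem cosetKL_coeff {a : W} (ha : a ∈ minReps cs (gens d)) {T : ℕ} (hT : IsKLTable T 178)
    {w x : ℕ} (hw : w < 178) (hx : x < 192) (k : ℕ) :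
    (cosetKL cs d a w x).coeff k = coef T w x k := by
  induction w using Nat.strong_induction_on generalizing x k with
  | _ w ih =>
    rcases Nat.eq_zero_or_pos w with rfl | h0
    · rw [hT.coef_zero hx]
      by_cases hx0 : x = 0
      · rw [hx0, cosetKL_self, coeff_one]; simp
      · rw [cosetKL_degree cs d ha (by lia) hx hx0, if_neg (by lia)]
        · rfl
        · rw [show rank 0 = 0 by decide +kernel]; lia
    have hw' : w < 192 := by lia
    rcases lt_or_ge k 5 with hk | hk
    · have hd := someDesc_facts w hw' h0.ne'
      have hrec := hT.recursion hw h0 hx hk rfl rfl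
      generalize someDesc w = s at hd hrec
      obtain ⟨l1, l2, -⟩ := lmul_facts w hw' s
      have hkl := cosetKL_lmul cs d ha (s := s) l1 hx (by rwa [l2])
      have hsx := (lmul_facts x hx s).1
      rw [l2] at hkl
      replace hkl := congrArg (fun p => p.coeff k) hkl
      have hv : lmul s w < 178 := by lia
      generalize lmul s w = v at hd hrec hkl l1 hv
      have hset : (Finset.range 192).filter (fun z => lmul s z < z ∧ Odd (rank v - rank z)) =
          (Finset.range v).filter (fun z => lmul s z < z ∧ Odd (rank v - rank z)) := by
        ext z
        simp only [Finset.mem_filter, Finset.mem_range]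
        refine ⟨fun ⟨h1, h2, h3⟩ => ⟨?_, h2, h3⟩, fun ⟨h1, h2⟩ => ⟨by lia, h2⟩⟩
        by_contra hle
        have h4 : rank v ≤ rank z := by
          rcases Nat.eq_or_lt_of_le (not_lt.mp hle) with rfl | h
          · exact le_rfl
          · exact rank_mono z h1 v h
        rw [Nat.sub_eq_zero_of_le h4] at h3
        simp at h3
      rw [hset] at hkl
      have e1 : ∀ z ∈ (Finset.range v).filter (fun z => lmul s z < z ∧ Odd (rank v - rank z)),
          ((C ((cosetKL cs d a v z).coeff ((rank v - rank z - 1) / 2)) *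
            Polynomial.X ^ ((rank v - rank z + 1) / 2)) * cosetKL cs d a z x).coeff k =
          ((coef T v z ((rank v - rank z - 1) / 2) * (if (rank v - rank z + 1) / 2 ≤ k then
            coef T z x (k - (rank v - rank z + 1) / 2) else 0) : ℕ) : ℤ) := by
        intro z hz
        have hzv := Finset.mem_range.mp (Finset.mem_filter.mp hz).1
        rw [mul_assoc, coeff_C_mul, coeff_X_pow_mul', ih v hd hv (by lia)]
        split_ifs
        · rw [ih z (by lia) (by lia) hx]; push_cast; rfl
        · simp
      have e2 : ∀ y < 192, (Polynomial.X * cosetKL cs d a v y).coeff k =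
          ((if k = 0 then 0 else coef T v y (k - 1) : ℕ) : ℤ) := by
        intro y hy
        rcases Nat.eq_zero_or_pos k with rfl | hk0
        · simp
        obtain ⟨j, rfl⟩ := Nat.exists_eq_add_of_lt hk0
        rw [zero_add, coeff_X_mul, ih v hd hv hy, if_neg (by lia)]; rfl
      rw [coeff_add, finsetSum_coeff, Finset.sum_congr rfl e1] at hkl
      have e3 := congrArg (fun m : ℕ => (m : ℤ)) hrec
      by_cases hsx' : lmul s x < x
      · rw [if_pos hsx', coeff_add, e2 x hx, ih v hd hv hsx] at hkl
        rw [if_pos hsx'] at e3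
        push_cast at hkl e3
        linarith
      · rw [if_neg hsx', coeff_add, e2 _ hsx, ih v hd hv hx] at hkl
        rw [if_neg hsx'] at e3
        push_cast at hkl e3
        linarith
    · -- the degree is at most `(9 - 1) / 2`
      rw [coef, cf_of_le (by lia)]
      by_cases hxw : x = w
      · rw [hxw, cosetKL_self, coeff_one, if_neg (by lia)]; rfl
      · rw [cosetKL_degree cs d ha hw' hx hxw]
        · rfl
        · have := rank_le_nine w hw
          lia

end Agreement

/-! ### The function `μ̃` on the cells of type `D_4` -/

instance : DecidableEq NodeType := fun a b => by
  cases a <;> cases b <;>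
    first
      | exact decidable_of_iff _ (iff_of_eq (NodeType.A.injEq _ _).symm)
      | exact decidable_of_iff _ (iff_of_eq (NodeType.B.injEq _ _).symm)
      | exact isTrue rfl
      | exact isFalse (by rintro ⟨⟩)

instance : DecidableEq CellName := fun a b => by
  cases a <;> cases b <;>
    first
      | exact decidable_of_iff _ (iff_of_eq (CellName.fourteenA.injEq _ _).symm)
      | exact decidable_of_iff _ (iff_of_eq (CellName.fourteenB.injEq _ _).symm)
      | exact isTrue rfl
      | exact isFalse (by rintro ⟨⟩)

instance : Fintype CellName where
  elems := {.tenA, .tenB, .fourteenA .l1, .fourteenA .l2, .fourteenA .l4, .fourteenB .l1,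
    .fourteenB .l2, .fourteenB .l4}
  complete := by rintro (_ | _ | ⟨_ | _ | _⟩ | ⟨_ | _ | _⟩) <;> decide

/-- The labelled elements of a cell, by their numbers. -/
def cellIdx (κ : CellName) : List (NodeType × ℕ) :=
  (diagram stdSub κ).map fun p => (p.1, wordIdx p.2)

/-- The pairs of numbers of elements of the same type in two cells. -/
def typePairs (κ κ' : CellName) : List (ℕ × ℕ) :=
  (cellIdx κ).flatMap fun p => ((cellIdx κ').filter fun p' => p.1 = p'.1).map fun p' => (p.2, p'.2)

/-- The Knuth map, on numbers in its domain. -/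
def knuthIdx (s t : Node) (x : ℕ) : ℕ :=
  if lmul t x < lmul s (lmul t x) then lmul s x else lmul t x

/-- The number `x` belongs to the domain of the Knuth map. -/
abbrev knuthDom (s t : Node) (x : ℕ) : Prop := lmul t x < x ∧ x < lmul s x

/-- A set of pairs of numbers, together with the images of its members under one Knuth map. -/
def transportStep (S : Finset (ℕ × ℕ)) : Finset (ℕ × ℕ) :=
  S ∪ S.biUnion fun p => (Finset.univ.filter fun n : Node × Node =>
    nodeOrder n.1 n.2 = 3 ∧ knuthDom n.1 n.2 p.1 ∧ knuthDom n.1 n.2 p.2).image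
      fun n => (knuthIdx n.1 n.2 p.1, knuthIdx n.1 n.2 p.2)

/-- The transports of a set of pairs of numbers, by at most eight Knuth maps in succession. These
are all transports if one more step adds nothing, which is part of `EdgeCount`. -/
def transports (S : Finset (ℕ × ℕ)) : Finset (ℕ × ℕ) := transportStep^[8] S

/-- The numbers of the end points of edges given by words. -/
def edgeIdx (E : List (List Node × List Node)) : Finset (ℕ × ℕ) :=
  (E.map fun p => (wordIdx p.1, wordIdx p.2)).toFinset

set_option maxRecDepth 100000 in
lemma cellIdx_lt : ∀ κ, ∀ p ∈ cellIdx κ, p.2 < 178 := by decide +kernel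

set_option maxRecDepth 100000 in
lemma cellIdx_disjoint : ∀ κ κ', ∀ p ∈ cellIdx κ, ∀ p' ∈ cellIdx κ', p.2 = p'.2 → κ = κ' := by
  decide +kernel

/-- The edges given by words form a set of three pairs of elements of the same type, with `n`
further transports, all of which are found by `transports`. -/
def EdgeCount (κ κ' : CellName) (E : List (List Node × List Node)) (n : ℕ) : Prop :=
  (edgeIdx E).card = 3 ∧ (transports (edgeIdx E) \ edgeIdx E).card = n ∧
    transportStep (transports (edgeIdx E)) ⊆ transports (edgeIdx E) ∧
    ∀ p ∈ transports (edgeIdx E), p ∈ typePairs κ κ'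

set_option maxRecDepth 100000 in
lemma edgeCount_ten : EdgeCount .tenA .tenB (edges10 stdSub) 7 := by
  unfold EdgeCount
  decide +kernel

set_option maxRecDepth 100000 in
lemma edgeCount_fourteen : ∀ i j k : Leg, j ≠ k → i ≠ j → i ≠ k →
    EdgeCount (.fourteenA j) (.fourteenB k) (edges14 stdSub i j k) 11 := by
  unfold EdgeCount
  decide +kernel

/-- `μ(x, y)`, from a table. -/
def muIdx (T x y : ℕ) : ℕ :=
  bif Nat.beq (Nat.mod (Nat.sub (rank y) (rank x)) 2) 1 then
    coef T y x (Nat.div (Nat.sub (Nat.sub (rank y) (rank x)) 1) 2) else 0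

/-- `μ̃(x, y)`, from a table. At most one of the summands is nonzero. -/
def muTildeIdx (T x y : ℕ) : ℕ := Nat.add (muIdx T x y) (muIdx T y x)

instance (κ κ' : CellName) : Decidable (Listed κ κ') :=
  match κ, κ' with
  | .tenA, .tenB => isTrue .ten_ten
  | .fourteenA j, .fourteenB k => decidable_of_iff (j ≠ k)
      ⟨fun h => .fourteen_fourteen j k h, by rintro ⟨⟩; assumption⟩
  | .tenA, .fourteenB j => isTrue (.ten_fourteen j)
  | .fourteenA j, .tenB => isTrue (.fourteen_ten j)
  | .tenA, .tenA | .tenA, .fourteenA _ | .tenB, _ | .fourteenA _, .tenA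
  | .fourteenA _, .fourteenA _ | .fourteenB _, _ => isFalse (by rintro ⟨⟩)

/-- The values of `μ̃` on the pairs of elements of the same type in two cells. -/
def MuSpec (T : ℕ) : Prop :=
  (∀ p ∈ typePairs .tenA .tenB, muTildeIdx T p.1 p.2 =
    if p ∈ transports (edgeIdx (edges10 stdSub)) then 1 else 0) ∧
  (∀ i j k : Leg, j ≠ k → i ≠ j → i ≠ k → ∀ p ∈ typePairs (.fourteenA j) (.fourteenB k),
    muTildeIdx T p.1 p.2 =
      if p ∈ transports (edgeIdx (edges14 stdSub i j k)) then 1 else 0) ∧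
  (∀ j : Leg, ∀ p ∈ typePairs .tenA (.fourteenB j), muTildeIdx T p.1 p.2 = 1) ∧
  (∀ j : Leg, ∀ p ∈ typePairs (.fourteenA j) .tenB, muTildeIdx T p.1 p.2 = 1) ∧
  (∀ κ κ' : CellName, ¬ Listed κ κ' → ¬ Listed κ' κ → ∀ p ∈ typePairs κ κ',
    muTildeIdx T p.1 p.2 = 0)

set_option maxRecDepth 100000 in
theorem muSpec_klTable : MuSpec klTable := by
  unfold MuSpec
  decide +kernel

/-! ### Clumps, Knuth maps and transports -/

section Transfer

variable {B W : Type*} [Group W] {M : CoxeterMatrix B} (cs : CoxeterSystem M W) (d : D4Sub M)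

lemma diagram_eq (κ : CellName) :
    diagram d κ = (diagram stdSub κ).map fun p => (p.1, p.2.map (gen d)) := by
  cases κ <;> rfl

/-- The pair of elements of the coset `W_{D_4} a` with given numbers. -/
noncomputable def embedPair (a : W) (p : ℕ × ℕ) : W × W := (embed cs d p.1 * a, embed cs d p.2 * a)

lemma exists_mem_diagram_iff {κ : CellName} {P : NodeType → W → Prop} :
    (∃ p ∈ diagram d κ, P p.1 (cs.wordProd p.2)) ↔ ∃ p ∈ cellIdx κ, P p.1 (embed cs d p.2) := by
  rw [diagram_eq, cellIdx]
  constructor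
  · rintro ⟨p, hp, h⟩
    obtain ⟨p', hp', rfl⟩ := List.mem_map.mp hp
    exact ⟨_, List.mem_map_of_mem hp', by simpa only [embed_wordIdx] using h⟩
  · rintro ⟨p, hp, h⟩
    obtain ⟨p', hp', rfl⟩ := List.mem_map.mp hp
    exact ⟨_, List.mem_map_of_mem hp', by simpa only [embed_wordIdx] using h⟩

lemma mem_cell_iff {κ : CellName} {u : W} :
    u ∈ cell cs d κ ↔ ∃ p ∈ cellIdx κ, u = embed cs d p.2 :=
  exists_mem_diagram_iff cs d (P := fun _ v => u = v)

lemma cellIdx_lt' {κ : CellName} {p : NodeType × ℕ} (hp : p ∈ cellIdx κ) : p.2 < 192 := by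
  have := cellIdx_lt κ p hp
  lia

lemma isProj_embed_mul_iff {a : W} (ha : a ∈ minReps cs (gens d)) {x y : ℕ} (hx : x < 192)
    (hy : y < 192) : IsProj cs (gens d) (embed cs d x * a) (embed cs d y) ↔ x = y := by
  constructor
  · rintro ⟨-, b, hb, h⟩
    exact embed_injOn cs d hx hy
      (minReps_unique cs (embed_mem cs d hx) (embed_mem cs d hy) ha hb h).1
  · rintro rfl
    exact ⟨embed_mem cs d hx, a, ha, rfl⟩

lemma hasType_embed_mul_iff {a : W} (ha : a ∈ minReps cs (gens d)) {x : ℕ} (hx : x < 192)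
    {t : NodeType} : HasType cs d (embed cs d x * a) t ↔ ∃ κ, (t, x) ∈ cellIdx κ := by
  refine exists_congr fun κ => ?_
  rw [exists_mem_diagram_iff cs d (P := fun t' v => t' = t ∧ IsProj cs (gens d) _ v)]
  constructor
  · rintro ⟨p, hp, rfl, h⟩
    rw [isProj_embed_mul_iff cs d ha hx (cellIdx_lt' hp)] at h
    rwa [h]
  · intro h
    exact ⟨_, h, rfl, (isProj_embed_mul_iff cs d ha hx hx).mpr rfl⟩

lemma cellIdx_nonempty (κ : CellName) : ∃ p, p ∈ cellIdx κ := by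
  cases κ <;> exact ⟨_, List.mem_cons_self⟩

/-- The clumps that lie in `X(κ)` are those of the cell `κ`. -/
lemma eq_of_subset_X {a : W} (ha : a ∈ minReps cs (gens d)) {κ κ' : CellName}
    (h : (fun u : W => u * a) '' cell cs d κ ⊆ X cs d κ') : κ = κ' := by
  obtain ⟨p, hp⟩ := cellIdx_nonempty κ
  obtain ⟨u, hu, h1⟩ := h ⟨_, (mem_cell_iff cs d).mpr ⟨p, hp, rfl⟩, rfl⟩
  obtain ⟨p', hp', rfl⟩ := (mem_cell_iff cs d).mp hu
  exact cellIdx_disjoint κ κ' p hp p' hp'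
    ((isProj_embed_mul_iff cs d ha (cellIdx_lt' hp) (cellIdx_lt' hp')).mp h1)

/-- Clumps in the same left coset of `W_{D_4}` have the same minimal representative. -/
lemma eq_of_subset_mul {a a' : W} (ha : a ∈ minReps cs (gens d)) (ha' : a' ∈ minReps cs (gens d))
    {κ κ' : CellName} (h : (fun u : W => u * a') '' cell cs d κ' ⊆
      (parabolic cs (gens d) : Set W) * (fun u : W => u * a) '' cell cs d κ) : a' = a := by
  obtain ⟨p, hp⟩ := cellIdx_nonempty κ'
  obtain ⟨g, hg, -, ⟨u, hu, rfl⟩, h1⟩ := h ⟨_, (mem_cell_iff cs d).mpr ⟨p, hp, rfl⟩, rfl⟩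
  obtain ⟨p', hp', rfl⟩ := (mem_cell_iff cs d).mp hu
  simp only [← mul_assoc] at h1
  exact (minReps_unique cs (embed_mem cs d (cellIdx_lt' hp))
    (Subgroup.mul_mem _ hg (embed_mem cs d (cellIdx_lt' hp'))) ha' ha h1.symm).2

lemma sameTypePairs_eq {a : W} (ha : a ∈ minReps cs (gens d)) (κ κ' : CellName) :
    sameTypePairs cs d ((fun u : W => u * a) '' cell cs d κ)
      ((fun u : W => u * a) '' cell cs d κ') = embedPair cs d a '' {p | p ∈ typePairs κ κ'} := by
  ext ⟨y, w⟩
  constructor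
  · rintro ⟨⟨u, hu, rfl⟩, ⟨u', hu', rfl⟩, t, h1, h2⟩
    obtain ⟨p, hp, rfl⟩ := (mem_cell_iff cs d).mp hu
    obtain ⟨p', hp', rfl⟩ := (mem_cell_iff cs d).mp hu'
    obtain ⟨κ₁, h1⟩ := (hasType_embed_mul_iff cs d ha (cellIdx_lt' hp)).mp h1
    obtain ⟨κ₂, h2⟩ := (hasType_embed_mul_iff cs d ha (cellIdx_lt' hp')).mp h2
    obtain rfl := cellIdx_disjoint _ _ _ h1 _ hp rfl
    obtain rfl := cellIdx_disjoint _ _ _ h2 _ hp' rfl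
    refine ⟨(p.2, p'.2), ?_, rfl⟩
    simp only [typePairs, Set.mem_ofPred_eq, List.mem_flatMap, List.mem_map, List.mem_filter,
      decide_eq_true_eq]
    exact ⟨_, h1, _, ⟨h2, rfl⟩, rfl⟩
  · rintro ⟨p, hp, h⟩
    simp only [typePairs, Set.mem_ofPred_eq, List.mem_flatMap, List.mem_map, List.mem_filter,
      decide_eq_true_eq] at hp
    obtain ⟨⟨t, x⟩, h1, ⟨t', x'⟩, ⟨h2, h3⟩, rfl⟩ := hp
    obtain ⟨rfl, rfl⟩ := Prod.mk.inj h
    obtain rfl : t = t' := h3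
    exact ⟨⟨_, (mem_cell_iff cs d).mpr ⟨_, h1, rfl⟩, rfl⟩,
      ⟨_, (mem_cell_iff cs d).mpr ⟨_, h2, rfl⟩, rfl⟩, t,
      (hasType_embed_mul_iff cs d ha (cellIdx_lt' h1)).mpr ⟨_, h1⟩,
      (hasType_embed_mul_iff cs d ha (cellIdx_lt' h2)).mpr ⟨_, h2⟩⟩

lemma mem_cellIdx_of_mem_typePairs {κ κ' : CellName} {p : ℕ × ℕ} (hp : p ∈ typePairs κ κ') :
    ∃ t, (t, p.1) ∈ cellIdx κ ∧ (t, p.2) ∈ cellIdx κ' := by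
  simp only [typePairs, List.mem_flatMap, List.mem_map, List.mem_filter, decide_eq_true_eq] at hp
  obtain ⟨⟨t, x⟩, h1, ⟨t', x'⟩, ⟨h2, h3⟩, rfl⟩ := hp
  obtain rfl : t = t' := h3
  exact ⟨t, h1, h2⟩

lemma embedPair_injOn (a : W) (κ κ' : CellName) :
    Set.InjOn (embedPair cs d a) {p | p ∈ typePairs κ κ'} := by
  intro p hp p' hp' h
  obtain ⟨t, h1, h2⟩ := mem_cellIdx_of_mem_typePairs hp
  obtain ⟨t', h1', h2'⟩ := mem_cellIdx_of_mem_typePairs hp'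
  obtain ⟨e1, e2⟩ := Prod.mk.inj h
  exact Prod.ext (embed_mul_injOn cs d a (cellIdx_lt' h1) (cellIdx_lt' h1') e1)
    (embed_mul_injOn cs d a (cellIdx_lt' h2) (cellIdx_lt' h2') e2)

lemma knuthDomain_embed_mul {a : W} (ha : a ∈ minReps cs (gens d)) {x : ℕ} (hx : x < 192)
    (s t : Node) : embed cs d x * a ∈ knuthDomain cs (gen d s) (gen d t) ↔ knuthDom s t x := by
  have := (lmul_facts x hx s).2.2.1
  rw [knuthDomain, Set.mem_ofPred_eq, isLeftDescent_embed_mul cs d ha hx,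
    isLeftDescent_embed_mul cs d ha hx, knuthDom]
  lia

/-- The projection of `w` to the subgroup of `s` and `t` is `t` exactly if `t w` is a minimal
representative. -/
lemma knuthMap_embed_mul {a : W} (ha : a ∈ minReps cs (gens d)) {x : ℕ} (hx : x < 192)
    {s t : Node} (ht : lmul t x < x) :
    knuthMap cs (gen d s) (gen d t) (embed cs d x * a) = embed cs d (knuthIdx s t x) * a := by
  obtain ⟨l1, l2, -⟩ := lmul_facts x hx t
  have l3 := (lmul_facts _ l1 s).2.2.1
  have h : IsProj cs {gen d s, gen d t} (embed cs d x * a) (cs.simple (gen d t)) ↔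
      lmul t x < lmul s (lmul t x) := by
    constructor
    · rintro ⟨-, b, hb, h⟩
      have hb' : b = embed cs d (lmul t x) * a := by
        rw [embed_lmul cs d hx, mul_assoc, h, cs.simple_mul_simple_cancel_left]
      have h1 := hb (gen d s) (by simp)
      rw [hb', isLeftDescent_embed_mul cs d ha l1] at h1
      lia
    · intro h
      refine ⟨Subgroup.subset_closure ⟨_, by simp, rfl⟩, embed cs d (lmul t x) * a, ?_, ?_⟩
      · rintro i (rfl | rfl)
        · rw [isLeftDescent_embed_mul cs d ha l1]; lia
        · rw [isLeftDescent_embed_mul cs d ha l1, l2]; lia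
      · rw [embed_lmul cs d hx, mul_assoc, cs.simple_mul_simple_cancel_left]
  rw [knuthMap, knuthIdx]
  split_ifs with h1 h2 h2
  · rw [embed_lmul cs d hx, mul_assoc]
  · exact absurd (h.mp h1) h2
  · exact absurd (h.mpr h2) h1
  · rw [embed_lmul cs d hx, mul_assoc]

/-- The words of `E`, with the simple reflections of `S_0` as letters. -/
def mapEdges (E : List (List Node × List Node)) : List (List B × List B) :=
  E.map fun p => (p.1.map (gen d), p.2.map (gen d))

lemma subset_transports (S : Finset (ℕ × ℕ)) : S ⊆ transports S := by
  suffices h : ∀ n (S : Finset (ℕ × ℕ)), S ⊆ transportStep^[n] S from h _ S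
  intro n
  induction n with
  | zero => exact fun S => subset_rfl
  | succ n ih =>
    exact fun S => Finset.subset_union_left.trans (ih (transportStep S))

lemma mem_transportStep {S : Finset (ℕ × ℕ)} {p : ℕ × ℕ} : p ∈ transportStep S ↔
    p ∈ S ∨ ∃ p' ∈ S, ∃ s t, (nodeOrder s t = 3 ∧ knuthDom s t p'.1 ∧ knuthDom s t p'.2) ∧
      (knuthIdx s t p'.1, knuthIdx s t p'.2) = p := by
  simp only [transportStep, Finset.mem_union, Finset.mem_biUnion, Finset.mem_image,
    Finset.mem_filter, Finset.mem_univ, true_and, Prod.exists]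

lemma knuthIdx_lt {x : ℕ} (hx : x < 192) (s t : Node) : knuthIdx s t x < 192 := by
  rw [knuthIdx]
  split_ifs
  exacts [(lmul_facts x hx s).1, (lmul_facts x hx t).1]

/-- The transports that are found in the model are transports in `W`. -/
lemma transported_of_mem_transports {a : W} (ha : a ∈ minReps cs (gens d)) {S : Finset (ℕ × ℕ)}
    (hS : ∀ p ∈ S, p.1 < 192 ∧ p.2 < 192) {p : ℕ × ℕ} (hp : p ∈ transports S) :
    Transported cs d (embedPair cs d a '' S) (embed cs d p.1 * a) (embed cs d p.2 * a) := by
  suffices h : ∀ n, ∀ p ∈ transportStep^[n] S, (p.1 < 192 ∧ p.2 < 192) ∧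
      Transported cs d (embedPair cs d a '' S) (embed cs d p.1 * a) (embed cs d p.2 * a) from
    (h _ p hp).2
  intro n
  induction n with
  | zero => exact fun p hp => ⟨hS p hp, .base ⟨p, hp, rfl⟩⟩
  | succ n ih =>
    intro p hp
    rw [Function.iterate_succ_apply', mem_transportStep] at hp
    rcases hp with hp | ⟨p', hp', s, t, ⟨h1, h2, h3⟩, rfl⟩
    · exact ih p hp
    · obtain ⟨⟨l1, l2⟩, ht⟩ := ih p' hp'
      refine ⟨⟨knuthIdx_lt l1 s t, knuthIdx_lt l2 s t⟩, ?_⟩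
      have h4 := Transported.step (gen_mem d s) (gen_mem d t) (by rw [order_gen, h1])
        ((knuthDomain_embed_mul cs d ha l1 s t).mpr h2)
        ((knuthDomain_embed_mul cs d ha l2 s t).mpr h3) ht
      rwa [knuthMap_embed_mul cs d ha l1 h2.1, knuthMap_embed_mul cs d ha l2 h3.1] at h4

/-- A set of pairs that is closed under one Knuth map in the model contains all transports. -/
lemma transported_subset {a : W} (ha : a ∈ minReps cs (gens d)) {S T : Finset (ℕ × ℕ)}
    (hT : ∀ p ∈ T, p.1 < 192 ∧ p.2 < 192) (hST : S ⊆ T) (hcl : transportStep T ⊆ T) {y w : W}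
    (h : Transported cs d (embedPair cs d a '' S) y w) : (y, w) ∈ embedPair cs d a '' T := by
  induction h with
  | base h => exact Set.image_mono (Finset.coe_subset.mpr hST) h
  | step hs ht hst hy hw _ ih =>
    obtain ⟨p, hp, h⟩ := ih
    obtain ⟨rfl, rfl⟩ := Prod.mk.inj h
    obtain ⟨s, rfl⟩ := exists_gen_of_mem d hs
    obtain ⟨t, rfl⟩ := exists_gen_of_mem d ht
    obtain ⟨l1, l2⟩ := hT p hp
    rw [knuthDomain_embed_mul cs d ha l1] at hy
    rw [knuthDomain_embed_mul cs d ha l2] at hw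
    rw [order_gen] at hst
    refine ⟨(knuthIdx s t p.1, knuthIdx s t p.2),
      hcl (mem_transportStep.mpr (.inr ⟨p, hp, s, t, ⟨hst, hy, hw⟩, rfl⟩)), ?_⟩
    rw [knuthMap_embed_mul cs d ha l1 hy.1, knuthMap_embed_mul cs d ha l2 hw.1]
    rfl

lemma baseEdges_eq {a : W} (ha : a ∈ minReps cs (gens d)) {κ κ' : CellName}
    {E : List (List Node × List Node)} (hE : ∀ p ∈ edgeIdx E, p ∈ typePairs κ κ') :
    baseEdges cs d (mapEdges d E) ((fun u : W => u * a) '' cell cs d κ)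
      ((fun u : W => u * a) '' cell cs d κ') = embedPair cs d a '' edgeIdx E := by
  ext ⟨y, w⟩
  constructor
  · rintro ⟨⟨u, hu, rfl⟩, ⟨u', hu', rfl⟩, e, he, h1, h2⟩
    obtain ⟨p, hp, rfl⟩ := (mem_cell_iff cs d).mp hu
    obtain ⟨p', hp', rfl⟩ := (mem_cell_iff cs d).mp hu'
    obtain ⟨e', he', rfl⟩ := List.mem_map.mp he
    rw [← embed_wordIdx, isProj_embed_mul_iff cs d ha (cellIdx_lt' hp) (wordIdx_lt _)] at h1
    rw [← embed_wordIdx, isProj_embed_mul_iff cs d ha (cellIdx_lt' hp') (wordIdx_lt _)] at h2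
    refine ⟨(p.2, p'.2), ?_, rfl⟩
    rw [h1, h2, edgeIdx, List.coe_toFinset]
    exact List.mem_map_of_mem
      (f := fun p : List Node × List Node => (wordIdx p.1, wordIdx p.2)) he'
  · rintro ⟨p, hp, h⟩
    obtain ⟨t, h1, h2⟩ := mem_cellIdx_of_mem_typePairs (hE p hp)
    obtain ⟨rfl, rfl⟩ := Prod.mk.inj h
    rw [edgeIdx, List.coe_toFinset] at hp
    obtain ⟨e, he, rfl⟩ := List.mem_map.mp hp
    refine ⟨⟨_, (mem_cell_iff cs d).mpr ⟨_, h1, rfl⟩, rfl⟩,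
      ⟨_, (mem_cell_iff cs d).mpr ⟨_, h2, rfl⟩, rfl⟩, _, List.mem_map_of_mem he, ?_, ?_⟩
    · rw [← embed_wordIdx, isProj_embed_mul_iff cs d ha (wordIdx_lt _) (wordIdx_lt _)]
    · rw [← embed_wordIdx, isProj_embed_mul_iff cs d ha (wordIdx_lt _) (wordIdx_lt _)]

/-- The condition `y ≤ w` in the definition of `μ` is redundant, since `P_{y,w} = 0` otherwise. -/
lemma mu_embed_mul {a : W} (ha : a ∈ minReps cs (gens d)) {T : ℕ} (hT : IsKLTable T 178)
    {x y : ℕ} (hx : x < 178) (hy : y < 178) :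
    mu cs (embed cs d x * a) (embed cs d y * a) = muIdx T x y := by
  have hx' : x < 192 := by lia
  have hy' : y < 192 := by lia
  have h1 : muIdx T x y = if Odd (rank y - rank x) then coef T y x ((rank y - rank x - 1) / 2)
      else 0 := by
    have h2 : Nat.beq (Nat.mod (Nat.sub (rank y) (rank x)) 2) 1 =
        decide (Odd (rank y - rank x)) := by
      rw [Bool.eq_iff_iff, Nat.beq_eq, decide_eq_true_iff, Nat.odd_iff]; rfl
    rw [muIdx, h2, Bool.cond_decide]
    rfl
  rw [mu, klPoly_eq, length_embed_mul cs d ha hx', length_embed_mul cs d ha hy',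
    Nat.add_sub_add_right, h1]
  have h2 := cosetKL_coeff cs d ha hT hy hx' ((rank y - rank x - 1) / 2)
  rw [cosetKL] at h2
  rw [h2]
  by_cases ho : Odd (rank y - rank x)
  · rw [if_pos ho]
    by_cases hle : BruhatLE cs (embed cs d x * a) (embed cs d y * a)
    · rw [if_pos ⟨hle, ho⟩]
    · rw [if_neg fun h => hle h.1, ← h2, (isKLFamily_klFamily cs _).support _ hle]
      rfl
  · rw [if_neg ho, if_neg fun h => ho h.2]
    rfl

lemma muTilde_embed_mul {a : W} (ha : a ∈ minReps cs (gens d)) {T : ℕ} (hT : IsKLTable T 178)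
    {x y : ℕ} (hx : x < 178) (hy : y < 178) :
    muTilde cs (embed cs d x * a) (embed cs d y * a) = muTildeIdx T x y := by
  have key : ∀ {x y : ℕ}, x < 178 → y < 178 →
      BruhatLE cs (embed cs d x * a) (embed cs d y * a) →
      mu cs (embed cs d y * a) (embed cs d x * a) = 0 := by
    intro x y hx hy h
    rw [mu, Nat.sub_eq_zero_of_le (BruhatLE.length_le cs h)]
    simp
  have h : (muTildeIdx T x y : ℤ) = mu cs (embed cs d x * a) (embed cs d y * a) +
      mu cs (embed cs d y * a) (embed cs d x * a) := by
    rw [mu_embed_mul cs d ha hT hx hy, mu_embed_mul cs d ha hT hy hx]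
    exact Nat.cast_add _ _
  rw [h, muTilde]
  split_ifs with h1 h2
  · rw [key hx hy h1, add_zero]
  · rw [key hy hx h2, zero_add]
  · rw [mu, if_neg fun h => h1 h.1, mu, if_neg fun h => h2 h.1, add_zero]

lemma muTilde_of_mem_sameTypePairs {a : W} (ha : a ∈ minReps cs (gens d)) {κ κ' : CellName}
    {e : W × W} (he : e ∈ sameTypePairs cs d ((fun u : W => u * a) '' cell cs d κ)
      ((fun u : W => u * a) '' cell cs d κ')) :
    ∃ p ∈ typePairs κ κ', e = embedPair cs d a p ∧
      muTilde cs e.1 e.2 = muTildeIdx klTable p.1 p.2 := by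
  rw [sameTypePairs_eq cs d ha] at he
  obtain ⟨p, hp, rfl⟩ := he
  obtain ⟨t, h1, h2⟩ := mem_cellIdx_of_mem_typePairs hp
  exact ⟨p, hp, rfl, muTilde_embed_mul cs d ha isKLTable_klTable (cellIdx_lt _ _ h1)
    (cellIdx_lt _ _ h2)⟩

/-- Edges between two clumps in the same coset, and their transports, as computed in the model. -/
theorem edges_of_edgeCount {a : W} (ha : a ∈ minReps cs (gens d)) {κ κ' : CellName}
    {E : List (List Node × List Node)} {n : ℕ} (hE : EdgeCount κ κ' E n)
    (hmu : ∀ p ∈ typePairs κ κ', muTildeIdx klTable p.1 p.2 =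
      if p ∈ transports (edgeIdx E) then 1 else 0)
    {C C' : Set W} (hC : C = (fun u : W => u * a) '' cell cs d κ)
    (hC' : C' = (fun u : W => u * a) '' cell cs d κ') :
    (baseEdges cs d (mapEdges d E) C C').ncard = 3 ∧
    (transportedEdges cs d (baseEdges cs d (mapEdges d E) C C') \
      baseEdges cs d (mapEdges d E) C C').ncard = n ∧
    transportedEdges cs d (baseEdges cs d (mapEdges d E) C C') ⊆ sameTypePairs cs d C C' ∧
    ∀ e ∈ sameTypePairs cs d C C',
      (e ∈ transportedEdges cs d (baseEdges cs d (mapEdges d E) C C') → muTilde cs e.1 e.2 = 1) ∧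
      (e ∉ transportedEdges cs d (baseEdges cs d (mapEdges d E) C C') →
        muTilde cs e.1 e.2 = 0) := by
  obtain ⟨c1, c2, c3, c4⟩ := hE
  have hsub := subset_transports (edgeIdx E)
  have hlt : ∀ p ∈ transports (edgeIdx E), p.1 < 192 ∧ p.2 < 192 := by
    intro p hp
    obtain ⟨t, h1, h2⟩ := mem_cellIdx_of_mem_typePairs (c4 p hp)
    exact ⟨cellIdx_lt' h1, cellIdx_lt' h2⟩
  have hbase : baseEdges cs d (mapEdges d E) C C' = embedPair cs d a '' edgeIdx E := by
    rw [hC, hC']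
    exact baseEdges_eq cs d ha fun p hp => c4 p (hsub hp)
  have htr : transportedEdges cs d (baseEdges cs d (mapEdges d E) C C') =
      embedPair cs d a '' transports (edgeIdx E) := by
    rw [hbase]
    refine Set.Subset.antisymm (fun e he => ?_) ?_
    · exact transported_subset cs d ha hlt hsub c3 he
    · rintro - ⟨p, hp, rfl⟩
      exact transported_of_mem_transports cs d ha (fun p hp => hlt p (hsub hp)) hp
  have hinj : Set.InjOn (embedPair cs d a) (transports (edgeIdx E)) :=
    (embedPair_injOn cs d a κ κ').mono fun p hp => c4 p hp
  rw [htr, hbase]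
  refine ⟨?_, ?_, ?_, fun e he => ?_⟩
  · rw [(hinj.mono (Finset.coe_subset.mpr hsub)).ncard_image, Set.ncard_coe_finset, c1]
  · rw [← hinj.image_sdiff_subset (Finset.coe_subset.mpr hsub), ← Finset.coe_sdiff,
      (hinj.mono (Finset.coe_subset.mpr Finset.sdiff_subset)).ncard_image,
      Set.ncard_coe_finset, c2]
  · rw [hC, hC', sameTypePairs_eq cs d ha]
    exact Set.image_mono fun p hp => c4 p hp
  · rw [hC, hC'] at he
    obtain ⟨p, hp, rfl, h⟩ := muTilde_of_mem_sameTypePairs cs d ha he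
    rw [h, hmu p hp]
    constructor
    · rintro ⟨p', hp', h1⟩
      rw [← embedPair_injOn cs d a κ κ' (c4 p' hp') hp h1, if_pos (Finset.mem_coe.mp hp')]
      rfl
    · intro hn
      rw [if_neg fun h1 => hn ⟨p, Finset.mem_coe.mpr h1, rfl⟩]
      rfl

end Transfer

end KLD4

theorem mainTheorem3 {B W : Type*} [Group W] {M : CoxeterMatrix B} (cs : CoxeterSystem M W)
    (d : D4Sub M) (C C' : Set W) (hC : IsClump cs d C) (hC' : IsClump cs d C')
    (hCC' : C' ⊆ (parabolic cs (gens d) : Set W) * C) :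
    -- between `X(10,a)` and `X(10,b)`: three edges and seven transports of them
    (C ⊆ X cs d .tenA → C' ⊆ X cs d .tenB →
      (baseEdges cs d (edges10 d) C C').ncard = 3 ∧
      (transportedEdges cs d (baseEdges cs d (edges10 d) C C') \
        baseEdges cs d (edges10 d) C C').ncard = 7 ∧
      transportedEdges cs d (baseEdges cs d (edges10 d) C C') ⊆ sameTypePairs cs d C C' ∧
      ∀ e ∈ sameTypePairs cs d C C',
        (e ∈ transportedEdges cs d (baseEdges cs d (edges10 d) C C') →
          muTilde cs e.1 e.2 = 1) ∧
        (e ∉ transportedEdges cs d (baseEdges cs d (edges10 d) C C') →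
          muTilde cs e.1 e.2 = 0)) ∧
    -- between `X(14,a,j)` and `X(14,b,k)` with `j ≠ k`: three edges and eleven transports of them
    (∀ i j k : Leg, j ≠ k → i ≠ j → i ≠ k →
      C ⊆ X cs d (.fourteenA j) → C' ⊆ X cs d (.fourteenB k) →
      (baseEdges cs d (edges14 d i j k) C C').ncard = 3 ∧
      (transportedEdges cs d (baseEdges cs d (edges14 d i j k) C C') \
        baseEdges cs d (edges14 d i j k) C C').ncard = 11 ∧
      transportedEdges cs d (baseEdges cs d (edges14 d i j k) C C') ⊆ sameTypePairs cs d C C' ∧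
      ∀ e ∈ sameTypePairs cs d C C',
        (e ∈ transportedEdges cs d (baseEdges cs d (edges14 d i j k) C C') →
          muTilde cs e.1 e.2 = 1) ∧
        (e ∉ transportedEdges cs d (baseEdges cs d (edges14 d i j k) C C') →
          muTilde cs e.1 e.2 = 0)) ∧
    -- between `X(10,a)` and `X(14,b,j)`
    (∀ j : Leg, C ⊆ X cs d .tenA → C' ⊆ X cs d (.fourteenB j) →
      ∀ e ∈ sameTypePairs cs d C C', muTilde cs e.1 e.2 = 1) ∧
    -- between `X(14,a,j)` and `X(10,b)`
    (∀ j : Leg, C ⊆ X cs d (.fourteenA j) → C' ⊆ X cs d .tenB →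
      ∀ e ∈ sameTypePairs cs d C C', muTilde cs e.1 e.2 = 1) ∧
    -- all unordered pairs of clumps that are not listed above
    (∀ κ κ' : CellName, ¬ Listed κ κ' → ¬ Listed κ' κ →
      C ⊆ X cs d κ → C' ⊆ X cs d κ' →
      ∀ e ∈ sameTypePairs cs d C C', muTilde cs e.1 e.2 = 0) := by
  obtain ⟨κ₀, a, ha, rfl⟩ := hC
  obtain ⟨κ₁, a', ha', rfl⟩ := hC'
  obtain rfl := eq_of_subset_mul cs d ha ha' hCC'
  obtain ⟨m1, m2, m3, m4, m5⟩ := muSpec_klTable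
  refine ⟨fun h h' => ?_, fun i j k hjk hij hik h h' => ?_, fun j h h' e he => ?_,
    fun j h h' e he => ?_, fun κ κ' hn hn' h h' e he => ?_⟩
  all_goals
    obtain rfl := eq_of_subset_X cs d ha h
    obtain rfl := eq_of_subset_X cs d ha h'
  · exact edges_of_edgeCount cs d ha edgeCount_ten m1 rfl rfl
  · exact edges_of_edgeCount cs d ha (edgeCount_fourteen i j k hjk hij hik)
      (m2 i j k hjk hij hik) rfl rfl
  · obtain ⟨p, hp, -, h⟩ := muTilde_of_mem_sameTypePairs cs d ha he
    rw [h, m3 j p hp]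
    rfl
  · obtain ⟨p, hp, -, h⟩ := muTilde_of_mem_sameTypePairs cs d ha he
    rw [h, m4 j p hp]
    rfl
  · obtain ⟨p, hp, -, h⟩ := muTilde_of_mem_sameTypePairs cs d ha he
    rw [h, m5 _ _ hn hn' p hp]
    rfl
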